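/- Let $0<\alpha<1$, $\gamma\in\mathbb R$, $\rho>0$, $a<b$, $T>0$, $k\in\mathbb N_0$, $\delta\in\mathbb R\setminus\{\tfrac12\}$ and $\kappa>0$. Let $u\in C^{k+2}([a,b]\times[0,T])$ satisfy $$ {}_0^C D_t^{\alpha,\gamma}u+\rho u-u_{xx}=f \ \text{ on } (a,b)\times(0,T],\qquad u(\cdot,0)=u_0,$$ with periodic boundary conditions $u(a,t)=u(b,t)$, $u_x(a,t)=u_x(b,t)$, where $$ {}_0^C D_t^{\alpha,\gamma}u(x,t)=\frac{e^{-\gamma t}}{\Gamma(1-\alpha)}\int_0^t\frac{\partial}{\partial s}\big[e^{\gamma s}u(x,s)\big]\frac{ds}{(t-s)^\alpha}.$$ Let $a=x_{1/2}<x_{3/2}<\dots<x_{N+1/2}=b$ with cells $I_j=[x_{j-1/2},x_{j+1/2}]$ of length $h_j$, $h=\max_j h_j$, $h_j\ge\kappa h$, and let $V_h^k$ be the space of functions that are polynomials of degree at most $k$ on each $I_j$. Write $v^{\pm}_{j+1/2}$ for the one-sided traces (taken periodically at the end points) and $v^{(\delta)}=\delta v^++(1-\delta)v^-$. Let $M\ge1$,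 $\tau=T/M$, $t_n=n\tau$, $b_i=(i+1)^{1-\alpha}-i^{1-\alpha}$, $f^n=f(\cdot,t_n)$. Let $u_h^n\in V_h^k$ $(0\le n\le M)$ and $p_h^n\in V_h^k$ $(1\le n\le M)$ satisfy, for $1\le n\le M$ and all $v,w\in V_h^k$, $$\begin{aligned} &\Big(\rho+\tfrac{\tau^{-\alpha}}{\Gamma(2-\alpha)}\Big)\int_a^b u_h^n v\,dx+\int_a^b p_h^n v_x\,dx-\sum_{j=1}^N\Big(\big((p_h^n)^{(1-\delta)}v^-\big)_{j+\frac12}-\big((p_h^n)^{(1-\delta)}v^+\big)_{j-\frac12}\Big)\\ &\quad=\tfrac{\tau^{-\alpha}}{\Gamma(2-\alpha)}\Big(\sum_{i=1}^{n-1}(b_{i-1}-b_i)e^{-i\gamma\tau}\int_a^b u_h^{n-i}v\,dx+b_{n-1}e^{-n\gamma\tau}\int_a^b u_h^0v\,dx\Big)+\int_a^b f^nv\,dx,\\ &\int_a^b p_h^n w\,dx+\int_a^b u_h^n w_x\,dx-\sum_{j=1}^N\Big(\big((u_h^n)^{(\delta)}w^-\big)_{j+\frac12}-\big((u_h^n)^{(\delta)}w^+\big)_{j-\frac12}\Big)=0,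 \end{aligned}$$ where $v_x,w_x$ are cellwise derivatives, and let $u_h^0\in V_h^k$ be the generalized Gauss–Radau projection of $u_0$: for all $j$, $\int_{I_j}(u_h^0-u_0)v\,dx=0$ for every polynomial $v$ of degree less than $k$, and $(u_h^0-u_0)^{(\delta)}_{j+1/2}=0$. Then there is a constant $C>0$, depending on $u$, $T$, $\alpha$ and the fixed data $a,b,\rho,\gamma,k,\delta,\kappa$ but not on the mesh ($N$, $h$), on $M$ (equivalently $\tau$), on $n$, or on the numerical solution, such that for all $0\le n\le M$ $$\|u(\cdot,t_n)-u_h^n\|_{L^2(a,b)}\le C\,\big(h^{k+1}+\tau^{2-\alpha}\big).$$ -/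

import Mathlib

noncomputable section

namespace TemperedLDG

/-- The tempered Caputo derivative
`(e^{-γ t} / Γ(1-α)) ∫₀ᵗ (d/ds)[e^{γ s} g(s)] (t-s)^{-α} ds` of a function `g` of time. -/
def temperedCaputo (α γ : ℝ) (g : ℝ → ℝ) (t : ℝ) : ℝ :=
  Real.exp (-γ * t) / Real.Gamma (1 - α) *
    ∫ s in (0 : ℝ)..t, deriv (fun r => Real.exp (γ * r) * g r) s / (t - s) ^ α

/-- `u` solves `D_t^{α,γ} u + ρ u - u_xx = f` on `(a,b) × (0,T]` with `u(x,0) = u₀(x)` and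
periodic boundary conditions (for `u` and for the flux `u_x`; the derivative at the end points
of `[a,b]` is the one-sided one). -/
structure IsExactSolution (α γ ρ a b T : ℝ) (f : ℝ → ℝ → ℝ) (u₀ : ℝ → ℝ)
    (u : ℝ → ℝ → ℝ) : Prop where
  equation : ∀ x ∈ Set.Ioo a b, ∀ t ∈ Set.Ioc 0 T,
    temperedCaputo α γ (fun s => u x s) t + ρ * u x t
      - iteratedDeriv 2 (fun y => u y t) x = f x t
  initial : ∀ x ∈ Set.Icc a b, u x 0 = u₀ x
  periodic : ∀ t ∈ Set.Icc 0 T, u a t = u b t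
  periodic_deriv : ∀ t ∈ Set.Icc 0 T,
    derivWithin (fun y => u y t) (Set.Icc a b) a = derivWithin (fun y => u y t) (Set.Icc a b) b

/-- A partition `a = node 0 < node 1 < ⋯ < node N = b` of `[a,b]` into `N` cells. -/
structure Mesh (a b : ℝ) (N : ℕ) where
  node : Fin (N + 1) → ℝ
  strictMono : StrictMono node
  first : node 0 = a
  last : node (Fin.last N) = b

namespace Mesh

variable {a b : ℝ} {N : ℕ}

/-- Left end point of a cell. -/
def left (m : Mesh a b N) (j : Fin N) : ℝ := m.node j.castSucc

/-- Right end point of a cell. -/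
def right (m : Mesh a b N) (j : Fin N) : ℝ := m.node j.succ

/-- Length of a cell. -/
def len (m : Mesh a b N) (j : Fin N) : ℝ := m.right j - m.left j

/-- The mesh size, that is, the maximal cell length. -/
def size (m : Mesh a b N) : ℝ := ⨆ j : Fin N, m.len j

/-- Quasi-uniformity with constant `κ`. -/
def QuasiUniform (m : Mesh a b N) (κ : ℝ) : Prop := ∀ j : Fin N, κ * m.size ≤ m.len j

end Mesh

/-- The discontinuous Galerkin space: on each of the `N` cells a polynomial of degree at most `k`.
An element is given by its polynomial on each cell. -/
def DGSpace (N k : ℕ) : Set (Fin N → Polynomial ℝ) :=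
  {v | ∀ j, v j ∈ Polynomial.degreeLT ℝ (k + 1)}

variable {a b : ℝ} {N : ℕ}

/-- `∫_Ω v w dx` for piecewise polynomials. -/
def pairing (m : Mesh a b N) (v w : Fin N → Polynomial ℝ) : ℝ :=
  ∑ j : Fin N, ∫ x in m.left j..m.right j, (v j).eval x * (w j).eval x

/-- `∫_Ω g v dx` for a function `g` and a piecewise polynomial `v`. -/
def load (m : Mesh a b N) (g : ℝ → ℝ) (v : Fin N → Polynomial ℝ) : ℝ :=
  ∑ j : Fin N, ∫ x in m.left j..m.right j, g x * (v j).eval x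

/-- `∫_Ω v w_x dx`, where `w_x` is the cellwise derivative. -/
def pairingDeriv (m : Mesh a b N) (v w : Fin N → Polynomial ℝ) : ℝ :=
  ∑ j : Fin N, ∫ x in m.left j..m.right j, (v j).eval x * (w j).derivative.eval x

/-- The weighted average `δ v⁺ + (1-δ) v⁻` at the right end point of cell `j`. The trace `v⁺`
comes from the next cell; addition in `Fin N` is cyclic, so the last cell is followed by the
first one (periodicity). -/
def weightedTrace [NeZero N] (m : Mesh a b N) (δ : ℝ) (v : Fin N → Polynomial ℝ)
    (j : Fin N) : ℝ :=
  δ * (v (j + 1)).eval (m.left (j + 1)) + (1 - δ) * (v j).eval (m.right j)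

/-- `∑_j ( (v^{(δ)} w⁻)_{j+1/2} - (v^{(δ)} w⁺)_{j-1/2} )`; the left end point of cell `j` is the
right end point of cell `j - 1` (cyclically). -/
def fluxTerm [NeZero N] (m : Mesh a b N) (δ : ℝ) (v w : Fin N → Polynomial ℝ) : ℝ :=
  ∑ j : Fin N, (weightedTrace m δ v j * (w j).eval (m.right j)
    - weightedTrace m δ v (j - 1) * (w j).eval (m.left j))

/-- `P` is the generalized Gauss-Radau projection of `g` with weight `δ`. -/
structure IsGaussRadauProj [NeZero N] (m : Mesh a b N) (k : ℕ) (δ : ℝ) (g : ℝ → ℝ)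
    (P : Fin N → Polynomial ℝ) : Prop where
  mem : P ∈ DGSpace N k
  orthogonal : ∀ j : Fin N, ∀ v ∈ Polynomial.degreeLT ℝ k,
    ∫ x in m.left j..m.right j, ((P j).eval x - g x) * v.eval x = 0
  trace : ∀ j : Fin N,
    δ * ((P (j + 1)).eval (m.left (j + 1)) - g (m.left (j + 1)))
      + (1 - δ) * ((P j).eval (m.right j) - g (m.right j)) = 0

/-- The weights `b_i = (i+1)^{1-α} - i^{1-α}`. -/
def l1Weight (α : ℝ) (i : ℕ) : ℝ := ((i : ℝ) + 1) ^ (1 - α) - (i : ℝ) ^ (1 - α)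

/-- `(uh n, ph n)`, `n = 0, …, M`, is a numerical solution of the fully discrete LDG scheme with
time step `τ` and generalized alternating fluxes `û = u^{(δ)}`, `p̂ = p^{(1-δ)}`, started from the
generalized Gauss-Radau projection of `u₀`. -/
structure IsLDGSolution [NeZero N] (α γ ρ δ τ : ℝ) (k M : ℕ) (m : Mesh a b N)
    (f : ℝ → ℝ → ℝ) (u₀ : ℝ → ℝ) (uh ph : ℕ → Fin N → Polynomial ℝ) : Prop where
  start : IsGaussRadauProj m k δ u₀ (uh 0)
  mem_u : ∀ n, 1 ≤ n → n ≤ M → uh n ∈ DGSpace N k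
  mem_p : ∀ n, 1 ≤ n → n ≤ M → ph n ∈ DGSpace N k
  scheme_u : ∀ n, 1 ≤ n → n ≤ M → ∀ v ∈ DGSpace N k,
    (ρ + τ ^ (-α) / Real.Gamma (2 - α)) * pairing m (uh n) v
        + pairingDeriv m (ph n) v - fluxTerm m (1 - δ) (ph n) v
      = τ ^ (-α) / Real.Gamma (2 - α) *
          (∑ i ∈ Finset.Icc 1 (n - 1),
              (l1Weight α (i - 1) - l1Weight α i) * Real.exp (-(i : ℝ) * γ * τ)
                * pairing m (uh (n - i)) v
            + l1Weight α (n - 1) * Real.exp (-(n : ℝ) * γ * τ) * pairing m (uh 0) v)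
        + load m (fun x => f x ((n : ℝ) * τ)) v
  scheme_p : ∀ n, 1 ≤ n → n ≤ M → ∀ w ∈ DGSpace N k,
    pairing m (ph n) w + pairingDeriv m (uh n) w - fluxTerm m δ (uh n) w = 0

/-- The `L²(a,b)` norm of `g - v`, for a function `g` and a piecewise polynomial `v`. -/
def l2Error (m : Mesh a b N) (g : ℝ → ℝ) (v : Fin N → Polynomial ℝ) : ℝ :=
  Real.sqrt (∑ j : Fin N, ∫ x in m.left j..m.right j, (g x - (v j).eval x) ^ 2)

end TemperedLDG

end

namespace TemperedLDG

open Set MeasureTheory Polynomial Filter Topology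

/-! Let `P n` be the Gauss–Radau projection of u(·,t_n) with weight δ, and Q that of u_x(·,t_n) with
weight 1-δ. The error splits into the projection error u - P and the discrete part ξ = P - uh,
accompanied by ζ = Q - ph. Moment and trace conditions are exactly what makes the volume and flux
terms of the projection errors drop out (`IsGaussRadauProj.weak_derivative`), so the discrete parts
solve the scheme with pointwise small residuals. Testing with ξ and ζ, the two fluxes cancel because
their weights are δ and 1-δ (`flux_cancel`), which gives `energy_step`.

The history weights b_{i-1} - b_i and b_{n-1} are nonnegative and sum to 1. After multiplication by
e^{2γt_n} the history is thus controlled by an average of earlier energies, and ρ > 0 absorbs the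
source: `l1_stability` bounds all energies at once, without a Gronwall factor and uniformly in τ.

The residuals have three sources. Projection errors are O(h^{k+1}) (`gaussRadau_accuracy`): cell
moments leave one Legendre coefficient per cell, and the traces give a cyclic two-term system for
these, solvable with uniform bounds since |1-δ| ≠ |δ|. The L1 truncation error is O(τ^{2-α})
(`l1_truncation`), applied to e^{γt}u. Finally the L1 difference of the projection error carries a
factor τ^{-α}; it stays O(h^{k+1}) because the projection is linear and unique, so time increments
of the weighted projection error are projection errors of increments, of size O(τ h^{k+1})
(`abs_l1_projection_error_le`). -/

/-! ### Moments, bounded projection and Legendre polynomial on the reference cell. -/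

/-- `W` is orthogonal on `[l,r]` to all polynomials of degree less than `k`. -/
noncomputable def OrthLT (l r : ℝ) (k : ℕ) (W : ℝ[X]) : Prop :=
  ∀ v ∈ degreeLT ℝ k, ∫ x in l..r, W.eval x * v.eval x = 0

theorem intervalIntegrable_poly_mul (l r : ℝ) (P Q : ℝ[X]) :
    IntervalIntegrable (fun x => P.eval x * Q.eval x) volume l r :=
  (P.continuous.mul Q.continuous).intervalIntegrable _ _

theorem OrthLT.add {l r : ℝ} {k : ℕ} {V W : ℝ[X]} (hV : OrthLT l r k V) (hW : OrthLT l r k W) :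
    OrthLT l r k (V + W) := by
  intro v hv
  simp only [eval_add, add_mul]
  rw [intervalIntegral.integral_add (intervalIntegrable_poly_mul _ _ _ _)
    (intervalIntegrable_poly_mul _ _ _ _), hV v hv, hW v hv, add_zero]

theorem OrthLT.C_mul {l r : ℝ} {k : ℕ} {W : ℝ[X]} (c : ℝ) (hW : OrthLT l r k W) :
    OrthLT l r k (C c * W) := by
  intro v hv
  simp only [eval_mul, eval_C, mul_assoc]
  rw [intervalIntegral.integral_const_mul, hW v hv, mul_zero]

theorem C_mul_mem_degreeLT {n : ℕ} {P : ℝ[X]} (c : ℝ) (hP : P ∈ degreeLT ℝ n) :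
    C c * P ∈ degreeLT ℝ n := by
  rw [← smul_eq_C_mul]
  exact Submodule.smul_mem _ _ hP

/-- A root at r allows W = (X - r)Q with deg Q < k. Testing W against Q gives ∫ (r - x)Q² = 0 with a
nonnegative integrand, so Q vanishes on the open interval and hence identically. -/
theorem OrthLT.eq_zero {l r : ℝ} (hlr : l < r) {k : ℕ} {W : ℝ[X]}
    (hW : W ∈ degreeLT ℝ (k + 1)) (ho : OrthLT l r k W) (h1 : W.eval r = 0) : W = 0 := by
  obtain ⟨Q, hQ⟩ := dvd_iff_isRoot.2 h1
  by_contra hne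
  have hQ0 : Q ≠ 0 := by
    rintro rfl
    exact hne (by simpa using hQ)
  have hQm : Q ∈ degreeLT ℝ k := by
    rw [mem_degreeLT] at hW ⊢
    rw [degree_eq_natDegree hne] at hW
    rw [degree_eq_natDegree hQ0]
    have : W.natDegree = 1 + Q.natDegree := by
      rw [hQ, natDegree_mul (X_sub_C_ne_zero r) hQ0, natDegree_X_sub_C]
    have h2 : W.natDegree < k + 1 := by exact_mod_cast hW
    have h3 : Q.natDegree < k := by omega
    exact_mod_cast h3
  have h0 := ho Q hQm
  have h4 : ∫ x in l..r, (r - x) * (Q.eval x) ^ 2 = 0 := by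
    rw [← neg_eq_zero, ← intervalIntegral.integral_neg, ← h0]
    refine intervalIntegral.integral_congr fun x _ => ?_
    simp only [hQ, eval_mul, eval_sub, eval_X, eval_C]
    ring
  have hcont : Continuous fun x => (r - x) * (Q.eval x) ^ 2 := by
    have := Q.continuous
    fun_prop
  have hz : ∀ x ∈ Ioo l r, Q.eval x = 0 := by
    intro x hx
    by_contra hx0
    have : 0 < ∫ x in l..r, (r - x) * (Q.eval x) ^ 2 := by
      refine intervalIntegral.integral_pos hlr hcont.continuousOn ?_ ⟨x, ⟨hx.1.le, hx.2.le⟩, ?_⟩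
      · intro y hy
        exact mul_nonneg (by linarith [hy.2]) (sq_nonneg _)
      · exact mul_pos (by linarith [hx.2]) (by positivity)
    exact this.ne' h4
  refine hQ0 (eq_zero_of_infinite_isRoot Q ((Ioo_infinite hlr).mono fun x hx => hz x hx))

/-- Moments against monomials of degree less than `k`, together with the value at `1`. -/
noncomputable def momentMap (k : ℕ) : degreeLT ℝ (k + 1) →ₗ[ℝ] (Fin k → ℝ) × ℝ where
  toFun W := (fun i => ∫ x in (-1 : ℝ)..1, (W : ℝ[X]).eval x * x ^ (i : ℕ), (W : ℝ[X]).eval 1)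
  map_add' V W := by
    ext i
    · simp only [Submodule.coe_add, eval_add, add_mul, Prod.fst_add, Pi.add_apply]
      exact intervalIntegral.integral_add
        (Continuous.intervalIntegrable (by have := (V : ℝ[X]).continuous; fun_prop) _ _)
        (Continuous.intervalIntegrable (by have := (W : ℝ[X]).continuous; fun_prop) _ _)
    · simp
  map_smul' c W := by
    ext i
    · simp only [Submodule.coe_smul, eval_smul, smul_eq_mul, mul_assoc, RingHom.id_apply,
        Prod.smul_fst, Pi.smul_apply]
      exact intervalIntegral.integral_const_mul _ _
    · simp

theorem integral_mul_eval_degreeLT {k : ℕ} {g : ℝ → ℝ} (hg : ContinuousOn g (Icc (-1) 1))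
    {v : ℝ[X]} (hv : v ∈ degreeLT ℝ k) :
    ∫ x in (-1 : ℝ)..1, g x * v.eval x
      = ∑ i : Fin k, v.coeff i * ∫ x in (-1 : ℝ)..1, g x * x ^ (i : ℕ) := by
  have : ∀ x, v.eval x = ∑ i : Fin k, v.coeff i * x ^ (i : ℕ) := by
    intro x
    have := eval_eq_sum_degreeLTEquiv hv x
    simpa [degreeLTEquiv] using this
  simp_rw [this, Finset.mul_sum]
  rw [intervalIntegral.integral_finsetSum]
  · refine Finset.sum_congr rfl fun i _ => ?_
    rw [← intervalIntegral.integral_const_mul]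
    refine intervalIntegral.integral_congr fun x _ => ?_
    ring
  · intro i _
    refine ContinuousOn.intervalIntegrable ?_
    rw [uIcc_of_le (by norm_num)]
    fun_prop

/-- Both sides have dimension k + 1, and injectivity is `OrthLT.eq_zero`. -/
theorem momentMap_surjective (k : ℕ) : Function.Surjective (momentMap k) := by
  have hfd : FiniteDimensional ℝ (degreeLT ℝ (k + 1)) :=
    Module.Finite.equiv (degreeLTEquiv ℝ (k + 1)).symm
  refine (LinearMap.injective_iff_surjective_of_finrank_eq_finrank ?_).1 ?_
  · rw [(degreeLTEquiv ℝ (k + 1)).finrank_eq]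
    simp
  · rw [injective_iff_map_eq_zero]
    intro W hW
    have h1 := congrArg Prod.fst hW
    have h2 : (W : ℝ[X]).eval 1 = 0 := congrArg Prod.snd hW
    refine Subtype.ext (OrthLT.eq_zero (l := -1) (r := 1) (by norm_num) W.2 (fun v hv => ?_) h2)
    rw [integral_mul_eval_degreeLT (W : ℝ[X]).continuous.continuousOn hv]
    refine Finset.sum_eq_zero fun i _ => ?_
    have : ∫ x in (-1 : ℝ)..1, (W : ℝ[X]).eval x * x ^ (i : ℕ) = 0 := congrFun h1 i
    rw [this, mul_zero]

theorem exists_poly_bound (P : ℝ[X]) :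
    ∃ C : ℝ, 0 ≤ C ∧ ∀ x ∈ Icc (-1 : ℝ) 1, |P.eval x| ≤ C := by
  obtain ⟨C, hC⟩ := isCompact_Icc.exists_bound_of_continuousOn
    (s := Icc (-1 : ℝ) 1) P.continuous.continuousOn
  exact ⟨C, (abs_nonneg _).trans (hC 0 (by norm_num)), hC⟩

/-- A bounded projection on the reference cell that preserves the moments of order below `k`. -/
theorem exists_ref_projection (k : ℕ) : ∃ K : ℝ, 0 ≤ K ∧ ∀ (g : ℝ → ℝ) (D : ℝ),
    ContinuousOn g (Icc (-1) 1) → (∀ x ∈ Icc (-1 : ℝ) 1, |g x| ≤ D) →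
    ∃ P ∈ degreeLT ℝ (k + 1),
      (∀ v ∈ degreeLT ℝ k, ∫ x in (-1 : ℝ)..1, (P.eval x - g x) * v.eval x = 0) ∧
      ∀ x ∈ Icc (-1 : ℝ) 1, |P.eval x| ≤ K * D := by
  classical
  -- The E i form a basis dual to the monomial moments, with end value 0. They depend on k alone,
  -- hence so does the bound; the factor 2 is the length of [-1,1].
  choose E hE using fun i : Fin k => momentMap_surjective k (Pi.single i 1, 0)
  choose B hB0 hB using fun i : Fin k => exists_poly_bound (E i : ℝ[X])
  refine ⟨∑ i, 2 * B i, Finset.sum_nonneg fun i _ => by linarith [hB0 i], fun g D hg hD => ?_⟩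
  set μ : Fin k → ℝ := fun i => ∫ x in (-1 : ℝ)..1, g x * x ^ (i : ℕ) with hμ
  have hμb : ∀ i, |μ i| ≤ 2 * D := by
    intro i
    have : ‖∫ x in (-1 : ℝ)..1, g x * x ^ (i : ℕ)‖ ≤ D * |1 - (-1 : ℝ)| := by
      refine intervalIntegral.norm_integral_le_of_norm_le_const fun x hx => ?_
      rw [uIoc_of_le (by norm_num)] at hx
      have hx' : x ∈ Icc (-1 : ℝ) 1 := ⟨hx.1.le, hx.2⟩
      rw [Real.norm_eq_abs, abs_mul, abs_pow]
      have h1 : |x| ^ (i : ℕ) ≤ 1 := pow_le_one₀ (abs_nonneg _) (abs_le.2 hx')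
      calc |g x| * |x| ^ (i : ℕ) ≤ |g x| * 1 := by gcongr
        _ ≤ D := by simpa using hD x hx'
    have h2 : |1 - (-1 : ℝ)| = 2 := by norm_num
    rw [h2, Real.norm_eq_abs] at this
    linarith
  set W : degreeLT ℝ (k + 1) := ∑ i, μ i • E i with hW
  have hWm : momentMap k W = (μ, 0) := by
    rw [hW, map_sum]
    simp only [map_smul, hE]
    ext i
    · simp [Prod.fst_sum, Finset.sum_apply, Pi.single_apply]
    · simp [Prod.snd_sum]
  refine ⟨W, W.2, fun v hv => ?_, fun x hx => ?_⟩
  · rw [integral_mul_eval_degreeLT (g := fun x => (W : ℝ[X]).eval x - g x)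
      ((W : ℝ[X]).continuous.continuousOn.sub hg) hv]
    refine Finset.sum_eq_zero fun i _ => ?_
    have h1 : ∫ x in (-1 : ℝ)..1, (W : ℝ[X]).eval x * x ^ (i : ℕ) = μ i :=
      congrFun (congrArg Prod.fst hWm) i
    have h2 : ∫ x in (-1 : ℝ)..1, ((W : ℝ[X]).eval x - g x) * x ^ (i : ℕ) = 0 := by
      simp only [sub_mul]
      rw [intervalIntegral.integral_sub, h1, hμ, sub_self]
      · exact Continuous.intervalIntegrable (by have := (W : ℝ[X]).continuous; fun_prop) _ _
      · refine ContinuousOn.intervalIntegrable ?_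
        rw [uIcc_of_le (by norm_num)]
        fun_prop
    rw [h2, mul_zero]
  · have : (W : ℝ[X]).eval x = ∑ i, μ i * (E i : ℝ[X]).eval x := by
      rw [hW]
      simp [eval_finsetSum]
    rw [this, Finset.sum_mul]
    refine (Finset.abs_sum_le_sum_abs _ _).trans (Finset.sum_le_sum fun i _ => ?_)
    rw [abs_mul]
    calc |μ i| * |(E i : ℝ[X]).eval x| ≤ (2 * D) * B i :=
          mul_le_mul (hμb i) (hB i x hx) (abs_nonneg _) ((abs_nonneg _).trans (hμb i))
      _ = 2 * B i * D := by ring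

theorem comp_affine_mem_degreeLT {n : ℕ} {P : ℝ[X]} (hP : P ∈ degreeLT ℝ n) (c d : ℝ) :
    P.comp (C c * X + C d) ∈ degreeLT ℝ n := by
  by_cases h : P.comp (C c * X + C d) = 0
  · rw [h]; exact Submodule.zero_mem _
  have hP0 : P ≠ 0 := by
    rintro rfl
    simp at h
  rw [mem_degreeLT, degree_eq_natDegree h]
  rw [mem_degreeLT, degree_eq_natDegree hP0] at hP
  refine lt_of_le_of_lt ?_ hP
  have h1 : (P.comp (C c * X + C d)).natDegree ≤ P.natDegree * (C c * X + C d).natDegree :=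
    natDegree_comp_le
  have h2 : (C c * X + C d).natDegree ≤ 1 := natDegree_linear_le
  have h3 : (P.comp (C c * X + C d)).natDegree ≤ P.natDegree := h1.trans (by nlinarith)
  exact_mod_cast h3

/-- The Legendre polynomial of degree `k`, normalised to be `1` at `1`. -/
theorem exists_ref_legendre (k : ℕ) : ∃ (L : ℝ[X]) (ε K : ℝ), |ε| = 1 ∧ 0 ≤ K ∧
    L ∈ degreeLT ℝ (k + 1) ∧ OrthLT (-1) 1 k L ∧ L.eval 1 = 1 ∧ L.eval (-1) = ε ∧
    ∀ x ∈ Icc (-1 : ℝ) 1, |L.eval x| ≤ K := by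
  obtain ⟨L, hL⟩ := momentMap_surjective k (0, 1)
  obtain ⟨K, hK0, hK⟩ := exists_poly_bound (L : ℝ[X])
  have h1 : (L : ℝ[X]).eval 1 = 1 := congrArg Prod.snd hL
  have ho : OrthLT (-1) 1 k (L : ℝ[X]) := by
    intro v hv
    rw [integral_mul_eval_degreeLT (L : ℝ[X]).continuous.continuousOn hv]
    refine Finset.sum_eq_zero fun i _ => ?_
    have : ∫ x in (-1 : ℝ)..1, (L : ℝ[X]).eval x * x ^ (i : ℕ) = 0 :=
      congrFun (congrArg Prod.fst hL) i
    rw [this, mul_zero]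
  set ε := (L : ℝ[X]).eval (-1) with hε
  -- Parity of Legendre polynomials without a formula: L(-x) - εL(x) is orthogonal and vanishes at
  -- 1, so it is zero; evaluation at -1 then gives ε² = 1.
  set L' : ℝ[X] := (L : ℝ[X]).comp (C (-1) * X + C 0) with hL'
  have ho' : OrthLT (-1) 1 k L' := by
    intro v hv
    have h2 := ho _ (comp_affine_mem_degreeLT hv (-1) 0)
    rw [← h2]
    have := intervalIntegral.integral_comp_neg (a := -1) (b := 1)
      (fun x => L'.eval x * v.eval x)
    simp only [neg_neg] at this
    rw [← this]
    refine intervalIntegral.integral_congr fun x _ => ?_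
    simp [hL']
  have hz : L' + C (-ε) * (L : ℝ[X]) = 0 := by
    refine OrthLT.eq_zero (l := -1) (r := 1) (by norm_num)
      (Submodule.add_mem _ (comp_affine_mem_degreeLT L.2 _ _) (C_mul_mem_degreeLT _ L.2))
      (ho'.add (ho.C_mul _)) ?_
    simp [hL', h1, ← hε]
  have he : ε * ε = 1 := by
    have := congrArg (eval (-1 : ℝ)) hz
    simp only [hL', eval_add, eval_comp, eval_mul, eval_C, eval_X, eval_zero, ← hε] at this
    norm_num [h1] at this
    linarith
  refine ⟨L, ε, K, ?_, hK0, L.2, ho, h1, rfl, hK⟩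
  rcases mul_self_eq_one_iff.1 he with h | h <;> simp [h]

/-! ### Affine transfer from the reference cell. -/

theorem integral_eq_ref {l r : ℝ} (hlr : l < r) (H : ℝ → ℝ) :
    ∫ x in l..r, H x
      = (r - l) / 2 * ∫ s in (-1 : ℝ)..1, H ((r - l) / 2 * s + (l + r) / 2) := by
  have h : (r - l) / 2 ≠ 0 := by
    have : 0 < r - l := sub_pos.2 hlr
    positivity
  rw [intervalIntegral.integral_comp_mul_add _ h, smul_eq_mul, mul_inv_cancel_left₀ h]
  congr 1 <;> ring

theorem ref_mem_iff {l r : ℝ} (hlr : l < r) {s : ℝ} :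
    (r - l) / 2 * s + (l + r) / 2 ∈ Icc l r ↔ s ∈ Icc (-1 : ℝ) 1 := by
  have h : 0 < (r - l) / 2 := by linarith
  simp only [mem_Icc]
  constructor
  · rintro ⟨h1, h2⟩
    constructor <;> by_contra! h3 <;> nlinarith
  · rintro ⟨h1, h2⟩
    constructor <;> nlinarith

/-- The affine map from `[l,r]` to the reference cell, as a polynomial. -/
noncomputable def toRef (l r : ℝ) : ℝ[X] := C (2 / (r - l)) * X + C (-(l + r) / (r - l))

theorem toRef_eval {l r : ℝ} (hlr : l < r) (s : ℝ) :
    (toRef l r).eval ((r - l) / 2 * s + (l + r) / 2) = s := by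
  have : r - l ≠ 0 := (sub_pos.2 hlr).ne'
  simp only [toRef, eval_add, eval_mul, eval_C, eval_X]
  field_simp
  ring

theorem exists_ref_coord {l r : ℝ} (hlr : l < r) {x : ℝ} (hx : x ∈ Icc l r) :
    ∃ s ∈ Icc (-1 : ℝ) 1, x = (r - l) / 2 * s + (l + r) / 2 := by
  have h : r - l ≠ 0 := (sub_pos.2 hlr).ne'
  have hx' : x = (r - l) / 2 * ((2 * x - (l + r)) / (r - l)) + (l + r) / 2 := by
    field_simp
    ring
  exact ⟨_, (ref_mem_iff hlr).1 (hx' ▸ hx), hx'⟩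

/-- A projection on a cell preserving the moments of order below `k`, bounded uniformly in the
cell. -/
theorem exists_cell_projection (k : ℕ) : ∃ K : ℝ, 0 ≤ K ∧ ∀ (l r : ℝ), l < r →
    ∀ (g : ℝ → ℝ) (D : ℝ), ContinuousOn g (Icc l r) →
    (∃ q ∈ degreeLT ℝ (k + 1), ∀ x ∈ Icc l r, |g x - q.eval x| ≤ D) →
    ∃ P ∈ degreeLT ℝ (k + 1),
      (∀ v ∈ degreeLT ℝ k, ∫ x in l..r, (P.eval x - g x) * v.eval x = 0) ∧
      ∀ x ∈ Icc l r, |P.eval x - g x| ≤ K * D := by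
  obtain ⟨K, hK0, hK⟩ := exists_ref_projection k
  refine ⟨K + 1, by positivity, ?_⟩
  rintro l r hlr g D hg ⟨q, hq, hqD⟩
  -- Only g - q is projected and q is added back, so the error is controlled by the distance D to
  -- the polynomial q; this yields K + 1.
  obtain ⟨P, hP, hPo, hPb⟩ := hK
    (fun s => g ((r - l) / 2 * s + (l + r) / 2) - q.eval ((r - l) / 2 * s + (l + r) / 2)) D
    (by
      refine ContinuousOn.sub (hg.comp (by fun_prop) fun s hs => (ref_mem_iff hlr).2 hs) ?_
      have := q.continuous
      exact Continuous.continuousOn (by fun_prop))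
    (fun s hs => hqD _ ((ref_mem_iff hlr).2 hs))
  refine ⟨P.comp (toRef l r) + q, Submodule.add_mem _ (comp_affine_mem_degreeLT hP _ _) hq,
    fun v hv => ?_, fun x hx => ?_⟩
  · rw [integral_eq_ref hlr]
    have := hPo _ (comp_affine_mem_degreeLT hv ((r - l) / 2) ((l + r) / 2))
    refine mul_eq_zero_of_right _ (this ▸ ?_)
    refine intervalIntegral.integral_congr fun s _ => ?_
    simp only [eval_add, eval_comp, toRef_eval hlr, eval_mul, eval_C, eval_X]
    ring
  · obtain ⟨s, hs, rfl⟩ := exists_ref_coord hlr hx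
    simp only [eval_add, eval_comp, toRef_eval hlr]
    calc _ = |P.eval s - (g ((r - l) / 2 * s + (l + r) / 2)
            - q.eval ((r - l) / 2 * s + (l + r) / 2))| := by congr 1; ring
      _ ≤ |P.eval s| + |g ((r - l) / 2 * s + (l + r) / 2)
            - q.eval ((r - l) / 2 * s + (l + r) / 2)| := abs_sub _ _
      _ ≤ K * D + D := add_le_add (hPb s hs) (hqD _ hx)
      _ = _ := by ring

/-- The Legendre polynomial of degree `k` on a cell. -/
theorem exists_cell_legendre (k : ℕ) : ∃ (ε K : ℝ), |ε| = 1 ∧ 0 ≤ K ∧ ∀ (l r : ℝ), l < r →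
    ∃ L ∈ degreeLT ℝ (k + 1), OrthLT l r k L ∧ L.eval r = 1 ∧ L.eval l = ε ∧
    ∀ x ∈ Icc l r, |L.eval x| ≤ K := by
  obtain ⟨L, ε, K, hε, hK0, hL, ho, h1, h2, hK⟩ := exists_ref_legendre k
  refine ⟨ε, K, hε, hK0, fun l r hlr => ⟨L.comp (toRef l r), comp_affine_mem_degreeLT hL _ _,
    fun v hv => ?_, ?_, ?_, fun x hx => ?_⟩⟩
  · rw [integral_eq_ref hlr]
    have := ho _ (comp_affine_mem_degreeLT hv ((r - l) / 2) ((l + r) / 2))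
    refine mul_eq_zero_of_right _ (this ▸ ?_)
    refine intervalIntegral.integral_congr fun s _ => ?_
    simp only [eval_add, eval_comp, toRef_eval hlr, eval_mul, eval_C, eval_X]
  · have := toRef_eval hlr 1
    rw [show (r - l) / 2 * 1 + (l + r) / 2 = r by ring] at this
    rw [eval_comp, this, h1]
  · have := toRef_eval hlr (-1)
    rw [show (r - l) / 2 * -1 + (l + r) / 2 = l by ring] at this
    rw [eval_comp, this, h2]
  · obtain ⟨s, hs, rfl⟩ := exists_ref_coord hlr hx
    rw [eval_comp, toRef_eval hlr]
    exact hK s hs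

/-! ### Mesh geometry, the cyclic trace system, and the generalized Gauss–Radau projection. -/

section

variable {a b : ℝ} {N : ℕ}

namespace Mesh

theorem left_lt_right (m : Mesh a b N) (j : Fin N) : m.left j < m.right j :=
  m.strictMono (Fin.castSucc_lt_succ)

theorem le_left (m : Mesh a b N) (j : Fin N) : a ≤ m.left j :=
  m.first.symm.trans_le (m.strictMono.monotone (Fin.zero_le _))

theorem right_le (m : Mesh a b N) (j : Fin N) : m.right j ≤ b :=
  (m.strictMono.monotone (Fin.le_last _)).trans_eq m.last

theorem Icc_subset (m : Mesh a b N) (j : Fin N) : Icc (m.left j) (m.right j) ⊆ Icc a b :=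
  Icc_subset_Icc (m.le_left j) (m.right_le j)

theorem left_mem (m : Mesh a b N) (j : Fin N) : m.left j ∈ Icc (m.left j) (m.right j) :=
  ⟨le_rfl, (m.left_lt_right j).le⟩

theorem right_mem (m : Mesh a b N) (j : Fin N) : m.right j ∈ Icc (m.left j) (m.right j) :=
  ⟨(m.left_lt_right j).le, le_rfl⟩

theorem len_le_size (m : Mesh a b N) (j : Fin N) : m.len j ≤ m.size :=
  le_ciSup (Set.finite_range m.len).bddAbove j

theorem size_pos [NeZero N] (m : Mesh a b N) : 0 < m.size :=
  (sub_pos.2 (m.left_lt_right 0)).trans_le (m.len_le_size 0)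

theorem sum_len (m : Mesh a b N) : ∑ j, m.len j = b - a := by
  have h1 := Fin.sum_univ_succ m.node
  have h2 := Fin.sum_univ_castSucc m.node
  rw [m.first] at h1
  rw [m.last] at h2
  simp only [len, left, right, Finset.sum_sub_distrib]
  linarith

/-- A periodic function takes the same value on both sides of a mesh node. -/
theorem periodic_node [NeZero N] (m : Mesh a b N) {g : ℝ → ℝ} (hg : g a = g b) (j : Fin N) :
    g (m.left (j + 1)) = g (m.right j) := by
  obtain ⟨n, rfl⟩ : ∃ n, N = n + 1 := ⟨N - 1, (Nat.succ_pred (NeZero.ne N)).symm⟩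
  by_cases hj : j = Fin.last n
  · subst hj
    have h1 : m.left (Fin.last n + 1) = a := by
      rw [Fin.last_add_one]
      exact m.first
    have h2 : m.right (Fin.last n) = b := m.last
    rw [h1, h2, hg]
  · have hlt : j < Fin.last n := Fin.lt_last_iff_ne_last.2 hj
    have : (j + 1).castSucc = j.succ := by
      ext
      simp [Fin.val_add_one_of_lt hlt]
    simp only [left, right, this]

end Mesh

/-- A maximum principle: at an index where |β| is maximal, read the equation in which the dominant
coefficient multiplies that entry. The other term is at most the smaller coefficient times the same
maximum. The bound is independent of N. -/
theorem abs_le_of_circulant [NeZero N] {p q R : ℝ} (hpq : |p| ≠ |q|) {β : Fin N → ℝ}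
    (h : ∀ j, |p * β j + q * β (j + 1)| ≤ R) (j : Fin N) : |β j| ≤ R / |(|p| - |q|)| := by
  obtain ⟨i, hi⟩ := Finite.exists_max fun j => |β j|
  refine (hi j).trans ?_
  rw [le_div_iff₀ (abs_pos.2 (sub_ne_zero.2 hpq))]
  rcases lt_or_gt_of_ne hpq with hlt | hgt
  · rw [abs_of_neg (sub_neg.2 hlt)]
    -- When q dominates, the maximal entry must stand in the second position, hence the cyclic
    -- predecessor.
    have h1 := h (i - 1)
    rw [sub_add_cancel] at h1
    have h2 : |q * β i| ≤ |p * β (i - 1) + q * β i| + |p * β (i - 1)| := by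
      have := abs_sub (p * β (i - 1) + q * β i) (p * β (i - 1))
      rwa [add_sub_cancel_left] at this
    rw [abs_mul, abs_mul p] at h2
    have h3 : |p| * |β (i - 1)| ≤ |p| * |β i| := mul_le_mul_of_nonneg_left (hi _) (abs_nonneg _)
    nlinarith
  · rw [abs_of_pos (sub_pos.2 hgt)]
    have h1 := h i
    have h2 : |p * β i| ≤ |p * β i + q * β (i + 1)| + |q * β (i + 1)| := by
      have := abs_sub (p * β i + q * β (i + 1)) (q * β (i + 1))
      rwa [add_sub_cancel_right] at this
    rw [abs_mul, abs_mul q] at h2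
    have h3 : |q| * |β (i + 1)| ≤ |q| * |β i| := mul_le_mul_of_nonneg_left (hi _) (abs_nonneg _)
    nlinarith

/-- The bound with R = 0 is injectivity, and the space is finite-dimensional. -/
theorem circulant_surjective [NeZero N] {p q : ℝ} (hpq : |p| ≠ |q|) (ρ : Fin N → ℝ) :
    ∃ β : Fin N → ℝ, ∀ j, p * β j + q * β (j + 1) = ρ j := by
  let A : (Fin N → ℝ) →ₗ[ℝ] (Fin N → ℝ) :=
    { toFun := fun β j => p * β j + q * β (j + 1)
      map_add' := fun x y => by ext j; simp only [Pi.add_apply]; ring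
      map_smul' := fun c x => by
        ext j
        simp only [Pi.smul_apply, smul_eq_mul, RingHom.id_apply]
        ring }
  have hinj : Function.Injective A := by
    rw [injective_iff_map_eq_zero]
    intro β hβ
    ext j
    have := abs_le_of_circulant (R := 0) hpq (β := β)
      (fun i => le_of_eq (abs_eq_zero.2 (congrFun hβ i))) j
    rw [zero_div] at this
    exact abs_nonpos_iff.1 this
  obtain ⟨β, hβ⟩ := LinearMap.injective_iff_surjective.1 hinj ρ
  exact ⟨β, fun j => congrFun hβ j⟩

theorem abs_one_sub_ne {δ : ℝ} (hδ : δ ≠ 1 / 2) : |1 - δ| ≠ |δ| := by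
  intro h
  rcases abs_eq_abs.1 h with h | h
  · exact hδ (by linarith)
  · linarith

theorem intervalIntegrable_cell {g : ℝ → ℝ} (hg : ContinuousOn g (Icc a b))
    (m : Mesh a b N) (j : Fin N) (v : ℝ[X]) :
    IntervalIntegrable (fun x => g x * v.eval x) volume (m.left j) (m.right j) := by
  refine ContinuousOn.intervalIntegrable ?_
  rw [uIcc_of_le (m.left_lt_right j).le]
  exact (hg.mono (m.Icc_subset j)).mul v.continuous.continuousOn

theorem integral_poly_sub {g : ℝ → ℝ} (hg : ContinuousOn g (Icc a b))
    (m : Mesh a b N) (j : Fin N) (P v : ℝ[X]) :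
    ∫ x in m.left j..m.right j, (P.eval x - g x) * v.eval x
      = (∫ x in m.left j..m.right j, P.eval x * v.eval x)
        - ∫ x in m.left j..m.right j, g x * v.eval x := by
  simp only [sub_mul]
  exact intervalIntegral.integral_sub (intervalIntegrable_poly_mul _ _ _ _)
    (intervalIntegrable_cell hg m j v)

/-- Linear combinations of Gauss-Radau projections. -/
theorem IsGaussRadauProj.lincomb [NeZero N] {m : Mesh a b N} {k : ℕ} {δ : ℝ} {g₁ g₂ : ℝ → ℝ}
    {P₁ P₂ : Fin N → ℝ[X]} (hg₁ : ContinuousOn g₁ (Icc a b)) (hg₂ : ContinuousOn g₂ (Icc a b))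
    (h₁ : IsGaussRadauProj m k δ g₁ P₁) (h₂ : IsGaussRadauProj m k δ g₂ P₂) (c₁ c₂ : ℝ) :
    IsGaussRadauProj m k δ (fun x => c₁ * g₁ x + c₂ * g₂ x)
      (fun j => C c₁ * P₁ j + C c₂ * P₂ j) where
  mem j := Submodule.add_mem _ (C_mul_mem_degreeLT _ (h₁.mem j)) (C_mul_mem_degreeLT _ (h₂.mem j))
  orthogonal j v hv := by
    have e : ∀ x, ((C c₁ * P₁ j + C c₂ * P₂ j).eval x - (c₁ * g₁ x + c₂ * g₂ x)) * v.eval x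
        = c₁ * (((P₁ j).eval x - g₁ x) * v.eval x) + c₂ * (((P₂ j).eval x - g₂ x) * v.eval x) := by
      intro x
      simp only [eval_add, eval_mul, eval_C]
      ring
    have i₁ := intervalIntegrable_cell (g := fun x => (P₁ j).eval x - g₁ x)
      ((P₁ j).continuous.continuousOn.sub hg₁) m j v
    have i₂ := intervalIntegrable_cell (g := fun x => (P₂ j).eval x - g₂ x)
      ((P₂ j).continuous.continuousOn.sub hg₂) m j v
    simp_rw [e]
    rw [intervalIntegral.integral_add (i₁.const_mul c₁) (i₂.const_mul c₂),
      intervalIntegral.integral_const_mul, intervalIntegral.integral_const_mul,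
      h₁.orthogonal j v hv, h₂.orthogonal j v hv]
    ring
  trace j := by
    have t₁ := h₁.trace j
    have t₂ := h₂.trace j
    simp only [eval_add, eval_mul, eval_C]
    linear_combination c₁ * t₁ + c₂ * t₂

theorem IsGaussRadauProj.congr [NeZero N] {m : Mesh a b N} {k : ℕ} {δ : ℝ} {g₁ g₂ : ℝ → ℝ}
    {P : Fin N → ℝ[X]} (h : IsGaussRadauProj m k δ g₁ P) (hg : ∀ x ∈ Icc a b, g₁ x = g₂ x) :
    IsGaussRadauProj m k δ g₂ P where
  mem := h.mem
  orthogonal j v hv := by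
    rw [← h.orthogonal j v hv]
    refine intervalIntegral.integral_congr fun x hx => ?_
    rw [uIcc_of_le (m.left_lt_right j).le] at hx
    simp only [hg x (m.Icc_subset j hx)]
  trace j := by
    rw [← hg _ (m.Icc_subset _ (m.left_mem _)), ← hg _ (m.Icc_subset _ (m.right_mem _))]
    exact h.trace j

/-- The difference W of two projections has vanishing moments, so on each cell it is its right trace
times the Legendre polynomial. The trace conditions become a homogeneous cyclic system with
coefficients 1-δ and δε, which has only the zero solution. -/
theorem IsGaussRadauProj.unique [NeZero N] {m : Mesh a b N} {k : ℕ} {δ : ℝ} (hδ : δ ≠ 1 / 2)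
    {g : ℝ → ℝ} (hg : ContinuousOn g (Icc a b)) {P₁ P₂ : Fin N → ℝ[X]}
    (h₁ : IsGaussRadauProj m k δ g P₁) (h₂ : IsGaussRadauProj m k δ g P₂) : P₁ = P₂ := by
  have h := (IsGaussRadauProj.lincomb hg hg h₁ h₂ 1 (-1)).congr (g₂ := fun _ => 0)
    (fun x _ => by ring)
  obtain ⟨ε, K, hε, hK0, hL⟩ := exists_cell_legendre k
  choose L hLm hLo hLr hLl hLb using fun j => hL _ _ (m.left_lt_right j)
  set W : Fin N → ℝ[X] := fun j => C 1 * P₁ j + C (-1) * P₂ j with hW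
  have hWL : ∀ j, W j + C (-(W j).eval (m.right j)) * L j = 0 := by
    intro j
    refine OrthLT.eq_zero (m.left_lt_right j)
      (Submodule.add_mem _ (h.mem j) (C_mul_mem_degreeLT _ (hLm j)))
      (OrthLT.add (fun v hv => ?_) ((hLo j).C_mul _)) ?_
    · simpa using h.orthogonal j v hv
    · simp [hLr]
  have hWl : ∀ j, (W j).eval (m.left j) = ε * (W j).eval (m.right j) := by
    intro j
    have := congrArg (eval (m.left j)) (hWL j)
    simp only [eval_add, eval_mul, eval_C, hLl, eval_zero] at this
    linarith
  have hpq : |1 - δ| ≠ |δ * ε| := by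
    rw [abs_mul, hε, mul_one]
    exact abs_one_sub_ne hδ
  have hβ := abs_le_of_circulant (R := 0) hpq (β := fun j => (W j).eval (m.right j)) fun j => by
    have := h.trace j
    simp only [sub_zero] at this
    rw [hWl] at this
    refine le_of_eq (abs_eq_zero.2 ?_)
    rw [← this]
    ring
  funext j
  have h0 : (W j).eval (m.right j) = 0 := by
    have := hβ j
    rw [zero_div] at this
    exact abs_nonpos_iff.1 this
  have h1 := hWL j
  rw [h0] at h1
  have h2 : P₁ j - P₂ j = 0 := by
    simpa [hW, ← sub_eq_add_neg] using h1
  exact sub_eq_zero.1 h2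

/-- The generalized Gauss-Radau projection exists and has optimal pointwise accuracy. -/
theorem exists_gaussRadau_bound (k : ℕ) {δ : ℝ} (hδ : δ ≠ 1 / 2) : ∃ K : ℝ, 0 ≤ K ∧
    ∀ {a b : ℝ} {N : ℕ} [NeZero N] (m : Mesh a b N) (g : ℝ → ℝ) (D : ℝ),
    ContinuousOn g (Icc a b) →
    (∀ j, ∃ q ∈ degreeLT ℝ (k + 1), ∀ x ∈ Icc (m.left j) (m.right j), |g x - q.eval x| ≤ D) →
    ∃ P, IsGaussRadauProj m k δ g P ∧
      ∀ j, ∀ x ∈ Icc (m.left j) (m.right j), |(P j).eval x - g x| ≤ K * D := by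
  obtain ⟨K₁, hK₁, hproj⟩ := exists_cell_projection k
  obtain ⟨ε, K₂, hε, hK₂, hleg⟩ := exists_cell_legendre k
  set R : ℝ := (|δ| + |1 - δ|) * K₁ / |(|1 - δ| - |δ * ε|)| with hR
  have hR0 : 0 ≤ R := by positivity
  have hpq : |1 - δ| ≠ |δ * ε| := by
    rw [abs_mul, hε, mul_one]
    exact abs_one_sub_ne hδ
  refine ⟨K₁ + R * K₂, by positivity, ?_⟩
  intro a b N _ m g D hg hD
  choose Q hQm hQo hQb using fun j => hproj _ _ (m.left_lt_right j) g D
    (hg.mono (m.Icc_subset j)) (hD j)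
  choose L hLm hLo hLr hLl hLb using fun j => hleg _ _ (m.left_lt_right j)
  have hD0 : 0 ≤ D := by
    obtain ⟨q, -, hq⟩ := hD 0
    exact (abs_nonneg _).trans (hq _ (m.left_mem 0))
  -- Adding Legendre multiples to the cellwise projections Q j leaves the moments intact; β is
  -- chosen to remove the trace defect of Q, itself of size O(D).
  obtain ⟨β, hβ⟩ := circulant_surjective hpq fun j =>
    -(δ * ((Q (j + 1)).eval (m.left (j + 1)) - g (m.left (j + 1)))
      + (1 - δ) * ((Q j).eval (m.right j) - g (m.right j)))
  have hβb : ∀ j, |β j| ≤ R * D := by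
    intro j
    have := abs_le_of_circulant (R := (|δ| + |1 - δ|) * K₁ * D) hpq (β := β) (fun j => ?_) j
    · calc |β j| ≤ _ := this
        _ = R * D := by rw [hR]; ring
    · rw [hβ j, abs_neg]
      refine (abs_add_le _ _).trans ?_
      rw [abs_mul, abs_mul]
      have h1 := mul_le_mul_of_nonneg_left (hQb (j + 1) _ (m.left_mem _)) (abs_nonneg δ)
      have h2 := mul_le_mul_of_nonneg_left (hQb j _ (m.right_mem _)) (abs_nonneg (1 - δ))
      linarith
  refine ⟨fun j => Q j + C (β j) * L j, ⟨fun j => ?_, fun j v hv => ?_, fun j => ?_⟩,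
    fun j x hx => ?_⟩
  · exact Submodule.add_mem _ (hQm j) (C_mul_mem_degreeLT _ (hLm j))
  · rw [integral_poly_sub hg]
    have h1 := hQo j v hv
    rw [integral_poly_sub hg] at h1
    simp only [eval_add, add_mul]
    rw [intervalIntegral.integral_add (intervalIntegrable_poly_mul _ _ _ _)
      (intervalIntegrable_poly_mul _ _ _ _), (hLo j).C_mul (β j) v hv, add_zero, h1]
  · have := hβ j
    simp only [eval_add, eval_mul, eval_C, hLl, hLr]
    linear_combination this
  · simp only [eval_add, eval_mul, eval_C]
    have h1 := hQb j x hx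
    have h2 : |β j * (L j).eval x| ≤ R * D * K₂ := by
      rw [abs_mul]
      exact mul_le_mul (hβb j) (hLb j x hx) (abs_nonneg _) (by positivity)
    calc _ = |((Q j).eval x - g x) + β j * (L j).eval x| := by congr 1; ring
      _ ≤ _ := abs_add_le _ _
      _ ≤ K₁ * D + R * D * K₂ := add_le_add h1 h2
      _ = _ := by ring

end

/-! ### The L1 weights and the L1 difference. -/

/-- The undamped L1 difference `y n - ∑ (b_{i-1} - b_i) y (n-i) - b_{n-1} y 0`. -/
noncomputable def l1Op (α : ℝ) (y : ℕ → ℝ) (n : ℕ) : ℝ :=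
  y n - ∑ i ∈ Finset.Icc 1 (n - 1), (l1Weight α (i - 1) - l1Weight α i) * y (n - i)
    - l1Weight α (n - 1) * y 0

theorem l1Weight_zero {α : ℝ} (hα : α < 1) : l1Weight α 0 = 1 := by
  have : (1 : ℝ) - α ≠ 0 := by linarith
  simp [l1Weight, Real.zero_rpow this]

theorem l1Weight_nonneg {α : ℝ} (hα : α < 1) (i : ℕ) : 0 ≤ l1Weight α i :=
  sub_nonneg.2 (Real.rpow_le_rpow (by positivity) (by linarith) (by linarith))

/-- Concavity of x^{1-α}, used at the midpoint i + 1 of i and i + 2. -/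
theorem l1Weight_succ_le {α : ℝ} (hα₀ : 0 < α) (hα : α < 1) (i : ℕ) :
    l1Weight α (i + 1) ≤ l1Weight α i := by
  have hc : ConcaveOn ℝ (Ici (0 : ℝ)) fun x : ℝ => x ^ (1 - α) :=
    Real.concaveOn_rpow (by linarith) (by linarith)
  have h := hc.2 (mem_Ici.2 (by positivity : (0 : ℝ) ≤ i))
    (mem_Ici.2 (by positivity : (0 : ℝ) ≤ (i : ℝ) + 2))
    (by norm_num : (0 : ℝ) ≤ 1 / 2) (by norm_num : (0 : ℝ) ≤ 1 / 2) (by norm_num)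
  simp only [smul_eq_mul] at h
  rw [show 1 / 2 * (i : ℝ) + 1 / 2 * ((i : ℝ) + 2) = i + 1 by ring] at h
  simp only [l1Weight, Nat.cast_add, Nat.cast_one]
  rw [show (i : ℝ) + 1 + 1 = i + 2 by ring]
  linarith

theorem l1Weight_sub_nonneg {α : ℝ} (hα₀ : 0 < α) (hα : α < 1) {i : ℕ} (hi : 1 ≤ i) :
    0 ≤ l1Weight α (i - 1) - l1Weight α i := by
  obtain ⟨j, rfl⟩ := Nat.exists_eq_add_of_le' hi
  exact sub_nonneg.2 (l1Weight_succ_le hα₀ hα j)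

theorem sum_l1Weight {α : ℝ} (hα : α < 1) (n : ℕ) :
    ∑ i ∈ Finset.range n, l1Weight α i = (n : ℝ) ^ (1 - α) := by
  have h := Finset.sum_range_sub (fun i : ℕ => (i : ℝ) ^ (1 - α)) n
  have h0 : (0 : ℝ) ^ (1 - α) = 0 := Real.zero_rpow (by linarith)
  simp only [Nat.cast_add, Nat.cast_one, Nat.cast_zero, h0, sub_zero] at h
  exact h

/-- Summation by parts. With z = 1 it says that the history weights sum to 1; with z the reversed
sequence it writes the L1 difference in terms of increments. -/
theorem abel_Icc (w z : ℕ → ℝ) (m : ℕ) :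
    ∑ i ∈ Finset.range (m + 1), w i * (z i - z (i + 1))
      = w 0 * z 0 - ∑ i ∈ Finset.Icc 1 m, (w (i - 1) - w i) * z i - w m * z (m + 1) := by
  induction m with
  | zero => simp; ring
  | succ m ih =>
    rw [Finset.sum_range_succ, ih, Finset.sum_Icc_succ_top (by omega)]
    simp only [Nat.add_sub_cancel]
    ring

theorem sum_l1Weight_sub {α : ℝ} (hα : α < 1) {n : ℕ} :
    ∑ i ∈ Finset.Icc 1 (n - 1), (l1Weight α (i - 1) - l1Weight α i) + l1Weight α (n - 1) = 1 := by
  have := abel_Icc (l1Weight α) (fun _ => 1) (n - 1)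
  simp only [sub_self, mul_zero, Finset.sum_const_zero, mul_one, l1Weight_zero hα] at this
  linarith

theorem l1Op_eq_sum {α : ℝ} (hα : α < 1) (y : ℕ → ℝ) {n : ℕ} (hn : 1 ≤ n) :
    l1Op α y n = ∑ m ∈ Finset.range n, l1Weight α (n - 1 - m) * (y (m + 1) - y m) := by
  obtain ⟨p, rfl⟩ := Nat.exists_eq_add_of_le' hn
  have h := abel_Icc (l1Weight α) (fun i => y (p + 1 - i)) p
  rw [← Finset.sum_range_reflect]
  simp only [l1Op, Nat.add_sub_cancel, l1Weight_zero hα, one_mul, Nat.sub_zero, Nat.sub_self] at h ⊢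
  rw [← h]
  refine Finset.sum_congr rfl fun i hi => ?_
  have hi' : i ≤ p := Nat.lt_succ_iff.1 (Finset.mem_range.1 hi)
  rw [show p - (p - i) = i by omega, show p - i + 1 = p + 1 - i by omega,
    show p + 1 - (i + 1) = p - i by omega]

theorem abs_l1Op_le {α : ℝ} (hα : α < 1) {y : ℕ → ℝ} {n : ℕ} (hn : 1 ≤ n) {A : ℝ}
    (hy : ∀ m < n, |y (m + 1) - y m| ≤ A) : |l1Op α y n| ≤ A * (n : ℝ) ^ (1 - α) := by
  rw [l1Op_eq_sum hα y hn, ← sum_l1Weight hα, Finset.mul_sum,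
    ← Finset.sum_range_reflect (fun i => A * l1Weight α i)]
  refine (Finset.abs_sum_le_sum_abs _ _).trans (Finset.sum_le_sum fun m hm => ?_)
  rw [abs_mul, abs_of_nonneg (l1Weight_nonneg hα _), mul_comm]
  exact mul_le_mul_of_nonneg_right (hy m (Finset.mem_range.1 hm)) (l1Weight_nonneg hα _)

/-! ### Truncation error of the L1 formula. -/

section Interpolation

variable {g g' : ℝ → ℝ} {c d L : ℝ}

theorem continuousOn_of_abs_sub_le {s : Set ℝ}
    (hL : ∀ x ∈ s, ∀ y ∈ s, |g' x - g' y| ≤ L * |x - y|) : ContinuousOn g' s := by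
  have : LipschitzOnWith (Real.toNNReal L) g' s := by
    refine LipschitzOnWith.of_dist_le_mul fun x hx y hy => ?_
    rw [Real.dist_eq, Real.dist_eq]
    exact (hL x hx y hy).trans
      (mul_le_mul_of_nonneg_right (Real.le_coe_toNNReal L) (abs_nonneg _))
  exact this.continuousOn

/-- Mean value inequality for g(x) - g'(s)x; a Lipschitz derivative replaces a bound on g''. -/
theorem abs_slope_sub_le (hcd : c < d)
    (hg : ∀ s ∈ Icc c d, HasDerivWithinAt g (g' s) (Icc c d) s)
    (hL : ∀ x ∈ Icc c d, ∀ y ∈ Icc c d, |g' x - g' y| ≤ L * |x - y|) (hL0 : 0 ≤ L)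
    {s : ℝ} (hs : s ∈ Icc c d) : |(g d - g c) / (d - c) - g' s| ≤ L * (d - c) := by
  have hpos : 0 < d - c := sub_pos.2 hcd
  have h := (convex_Icc c d).norm_image_sub_le_of_norm_hasDerivWithin_le
    (f := fun x => g x - g' s * x) (f' := fun x => g' x - g' s) (C := L * (d - c))
    (fun x hx => (hg x hx).fun_sub
      (by simpa using (hasDerivWithinAt_id x (Icc c d)).const_mul (g' s)))
    (fun x hx => (hL x hx s hs).trans (mul_le_mul_of_nonneg_left
      (abs_sub_le_iff.2 ⟨by linarith [hx.2, hs.1], by linarith [hx.1, hs.2]⟩) hL0))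
    (left_mem_Icc.2 hcd.le) (right_mem_Icc.2 hcd.le)
  simp only [Real.norm_eq_abs, abs_of_pos hpos] at h
  rw [show (g d - g c) / (d - c) - g' s = (g d - g' s * d - (g c - g' s * c)) / (d - c) by
    field_simp; ring, abs_div, abs_of_pos hpos, div_le_iff₀ hpos]
  exact h

theorem integral_slope_sub (hcd : c < d)
    (hg : ∀ s ∈ Icc c d, HasDerivWithinAt g (g' s) (Icc c d) s) (hg' : ContinuousOn g' (Icc c d)) :
    ∫ s in c..d, ((g d - g c) / (d - c) - g' s) = 0 := by
  have hi : IntervalIntegrable g' volume c d :=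
    ContinuousOn.intervalIntegrable (by rwa [uIcc_of_le hcd.le])
  rw [intervalIntegral.integral_sub intervalIntegrable_const hi, intervalIntegral.integral_const,
    intervalIntegral.integral_eq_sub_of_hasDerivAt_of_le hcd.le
      (fun s hs => (hg s hs).continuousWithinAt)
      (fun s hs => (hg s (Ioo_subset_Icc_self hs)).hasDerivAt (Icc_mem_nhds hs.1 hs.2)) hi,
    smul_eq_mul, mul_div_cancel₀ _ (sub_pos.2 hcd).ne', sub_self]

theorem slope_mul_integral_sub (hcd : c < d) (hg' : ContinuousOn g' (Icc c d)) {κ : ℝ → ℝ}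
    (hκ : IntervalIntegrable κ volume c d) (A : ℝ) :
    A * (∫ s in c..d, κ s) - ∫ s in c..d, g' s * κ s = ∫ s in c..d, (A - g' s) * κ s := by
  have hg'u : ContinuousOn g' (uIcc c d) := by rwa [uIcc_of_le hcd.le]
  simp only [sub_mul]
  rw [intervalIntegral.integral_sub (hκ.const_mul A) (hκ.continuousOn_mul hg'u),
    intervalIntegral.integral_const_mul]

/-- The slope error has mean zero, so the constant κ c may be subtracted from the kernel. What
remains is the variation κ d - κ c, which telescopes over cells; bounding the kernel itself would
lose this gain. -/
theorem slope_kernel_bound_of_monotone (hcd : c < d)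
    (hg : ∀ s ∈ Icc c d, HasDerivWithinAt g (g' s) (Icc c d) s)
    (hL : ∀ x ∈ Icc c d, ∀ y ∈ Icc c d, |g' x - g' y| ≤ L * |x - y|) (hL0 : 0 ≤ L)
    {κ : ℝ → ℝ} (hκ : MonotoneOn κ (Icc c d)) :
    |(g d - g c) / (d - c) * (∫ s in c..d, κ s) - ∫ s in c..d, g' s * κ s|
      ≤ L * (d - c) ^ 2 * (κ d - κ c) := by
  have hg' := continuousOn_of_abs_sub_le hL
  have hu : uIcc c d = Icc c d := uIcc_of_le hcd.le
  have hκi : IntervalIntegrable κ volume c d := MonotoneOn.intervalIntegrable (by rwa [hu])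
  have hpos : 0 < d - c := sub_pos.2 hcd
  set A := (g d - g c) / (d - c) with hA
  have hAc : ContinuousOn (fun s => A - g' s) (uIcc c d) := by
    rw [hu]
    exact continuousOn_const.sub hg'
  have e : ∫ s in c..d, (A - g' s) * κ s = ∫ s in c..d, (A - g' s) * (κ s - κ c) := by
    simp only [mul_sub _ _ (κ c)]
    rw [intervalIntegral.integral_sub (hκi.continuousOn_mul hAc)
      (hAc.intervalIntegrable.mul_const _), intervalIntegral.integral_mul_const,
      integral_slope_sub hcd hg hg', zero_mul, sub_zero]
  rw [slope_mul_integral_sub hcd hg' hκi, e]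
  have := intervalIntegral.norm_integral_le_of_norm_le_const (a := c) (b := d)
    (f := fun s => (A - g' s) * (κ s - κ c)) (C := L * (d - c) * (κ d - κ c)) fun s hs => by
      rw [uIoc_of_le hcd.le] at hs
      have hs' : s ∈ Icc c d := ⟨hs.1.le, hs.2⟩
      have h1 : 0 ≤ κ s - κ c := sub_nonneg.2 (hκ (left_mem_Icc.2 hcd.le) hs' hs.1.le)
      have h2 : κ s - κ c ≤ κ d - κ c :=
        sub_le_sub_right (hκ hs' (right_mem_Icc.2 hcd.le) hs.2) _
      rw [Real.norm_eq_abs, abs_mul, abs_of_nonneg h1]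
      exact mul_le_mul (abs_slope_sub_le hcd hg hL hL0 hs') h2 h1 (by positivity)
  rw [Real.norm_eq_abs, abs_of_pos hpos] at this
  refine this.trans_eq (by ring)

/-- The cruder bound needed on the last time cell, where the kernel is singular but integrable. -/
theorem slope_kernel_bound (hcd : c < d)
    (hg : ∀ s ∈ Icc c d, HasDerivWithinAt g (g' s) (Icc c d) s)
    (hL : ∀ x ∈ Icc c d, ∀ y ∈ Icc c d, |g' x - g' y| ≤ L * |x - y|) (hL0 : 0 ≤ L)
    {κ : ℝ → ℝ} (hκ : IntervalIntegrable κ volume c d) (hκ0 : ∀ s ∈ Icc c d, 0 ≤ κ s) :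
    |(g d - g c) / (d - c) * (∫ s in c..d, κ s) - ∫ s in c..d, g' s * κ s|
      ≤ L * (d - c) * ∫ s in c..d, κ s := by
  have hg' := continuousOn_of_abs_sub_le hL
  rw [slope_mul_integral_sub hcd hg' hκ, ← intervalIntegral.integral_const_mul,
    ← Real.norm_eq_abs]
  refine intervalIntegral.norm_integral_le_of_norm_le hcd.le
    (Filter.Eventually.of_forall fun s hs => ?_) (hκ.const_mul _)
  have hs' : s ∈ Icc c d := ⟨hs.1.le, hs.2⟩
  rw [Real.norm_eq_abs, abs_mul, abs_of_nonneg (hκ0 s hs')]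
  exact mul_le_mul_of_nonneg_right (abs_slope_sub_le hcd hg hL hL0 hs') (hκ0 s hs')

end Interpolation

theorem intervalIntegrable_kernel {α : ℝ} (hα : α < 1) (t c d : ℝ) :
    IntervalIntegrable (fun s => (t - s) ^ (-α)) volume c d := by
  have h := (intervalIntegral.intervalIntegrable_rpow' (a := t - c) (b := t - d)
    (r := -α) (by linarith)).comp_sub_left t
  simpa using h

theorem integral_kernel {α : ℝ} (hα : α < 1) (t c d : ℝ) :
    ∫ s in c..d, (t - s) ^ (-α) = ((t - c) ^ (1 - α) - (t - d) ^ (1 - α)) / (1 - α) := by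
  rw [intervalIntegral.integral_comp_sub_left (fun s => s ^ (-α)) t,
    integral_rpow (Or.inl (by linarith))]
  simp only [neg_add_eq_sub]

/-- The L1 formula approximates the Caputo derivative to order `2 - α`. -/
theorem l1_truncation {α τ L : ℝ} (hα₀ : 0 < α) (hα : α < 1) (hτ : 0 < τ) {n : ℕ} (hn : 1 ≤ n)
    {g g' : ℝ → ℝ} (hL0 : 0 ≤ L)
    (hg : ∀ s ∈ Icc 0 (n * τ), HasDerivWithinAt g (g' s) (Icc 0 (n * τ)) s)
    (hL : ∀ x ∈ Icc 0 (n * τ), ∀ y ∈ Icc 0 (n * τ), |g' x - g' y| ≤ L * |x - y|) :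
    |τ ^ (-α) / Real.Gamma (2 - α) * l1Op α (fun m => g (m * τ)) n
        - 1 / Real.Gamma (1 - α) * ∫ s in (0 : ℝ)..n * τ, deriv g s / (n * τ - s) ^ α|
      ≤ L * (1 + 1 / (1 - α)) / Real.Gamma (1 - α) * τ ^ (2 - α) := by
  obtain ⟨p, rfl⟩ := Nat.exists_eq_add_of_le' hn
  set t : ℝ := ((p + 1 : ℕ) : ℝ) * τ with ht
  have ht' : t = p * τ + τ := by rw [ht]; push_cast; ring
  have hα' : 0 < 1 - α := by linarith
  have hΓ : 0 < Real.Gamma (1 - α) := Real.Gamma_pos_of_pos hα'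
  have hΓ2 : Real.Gamma (2 - α) = (1 - α) * Real.Gamma (1 - α) := by
    rw [← Real.Gamma_add_one hα'.ne']
    congr 1
    ring
  have ht0 : 0 ≤ t := by positivity
  have hg' := continuousOn_of_abs_sub_le hL
  -- Compared on the open interval only: `deriv` is two-sided and nothing is known about g beyond
  -- the end points.
  have hI : ∫ s in (0 : ℝ)..t, deriv g s / (t - s) ^ α = ∫ s in (0 : ℝ)..t, g' s * (t - s) ^ (-α) := by
    refine intervalIntegral.integral_congr_Ioo_of_le ht0 fun s hs => ?_
    have h1 : deriv g s = g' s :=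
      ((hg s (Ioo_subset_Icc_self hs)).hasDerivAt (Icc_mem_nhds hs.1 hs.2)).deriv
    simp only [h1, Real.rpow_neg (sub_nonneg.2 hs.2.le), div_eq_mul_inv]
  have hsub : ∀ m < p + 1, Icc ((m : ℝ) * τ) (((m + 1 : ℕ) : ℝ) * τ) ⊆ Icc 0 t := by
    intro m hm
    refine Icc_subset_Icc (by positivity) (mul_le_mul_of_nonneg_right ?_ hτ.le)
    exact_mod_cast hm
  have hlt : ∀ m : ℕ, (m : ℝ) * τ < ((m + 1 : ℕ) : ℝ) * τ := by
    intro m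
    push_cast
    linarith
  have hsplit : ∫ s in (0 : ℝ)..t, g' s * (t - s) ^ (-α)
      = ∑ m ∈ Finset.range (p + 1),
        ∫ s in (m : ℝ) * τ..((m + 1 : ℕ) : ℝ) * τ, g' s * (t - s) ^ (-α) := by
    rw [intervalIntegral.sum_integral_adjacent_intervals (a := fun m : ℕ => (m : ℝ) * τ)]
    · simp [ht]
    · intro m hm
      refine (intervalIntegrable_kernel hα t _ _).continuousOn_mul ?_
      rw [uIcc_of_le (hlt m).le]
      exact hg'.mono (hsub m hm)
  have hw : ∀ m < p + 1, ∫ s in (m : ℝ) * τ..((m + 1 : ℕ) : ℝ) * τ, (t - s) ^ (-α)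
      = τ ^ (1 - α) * l1Weight α (p - m) / (1 - α) := by
    intro m hm
    have hmp : m ≤ p := Nat.lt_succ_iff.1 hm
    rw [integral_kernel hα, l1Weight, mul_sub, ← Real.mul_rpow hτ.le (by positivity),
      ← Real.mul_rpow hτ.le (by positivity), Nat.cast_sub hmp]
    congr 3 <;> rw [ht'] <;> push_cast <;> ring
  have hτp : τ ^ (1 - α) = τ * τ ^ (-α) := by
    rw [sub_eq_add_neg, Real.rpow_add hτ, Real.rpow_one]
  have hτ2 : τ ^ (2 - α) = τ ^ 2 * τ ^ (-α) := by
    rw [sub_eq_add_neg, Real.rpow_add hτ, Real.rpow_two]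
  -- The L1 formula is the kernel integrated against the slopes of the piecewise linear interpolant,
  -- so the error is a sum of local slope errors.
  have hdiff : τ ^ (-α) / Real.Gamma (2 - α) * l1Op α (fun m => g (m * τ)) (p + 1)
        - 1 / Real.Gamma (1 - α) * ∫ s in (0 : ℝ)..t, deriv g s / (t - s) ^ α
      = 1 / Real.Gamma (1 - α) * ∑ m ∈ Finset.range (p + 1),
        ((g (((m + 1 : ℕ) : ℝ) * τ) - g (m * τ)) / (((m + 1 : ℕ) : ℝ) * τ - m * τ)
            * (∫ s in (m : ℝ) * τ..((m + 1 : ℕ) : ℝ) * τ, (t - s) ^ (-α))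
          - ∫ s in (m : ℝ) * τ..((m + 1 : ℕ) : ℝ) * τ, g' s * (t - s) ^ (-α)) := by
    rw [hI, hsplit, Finset.sum_sub_distrib, mul_sub, l1Op_eq_sum hα _ hn, hΓ2]
    congr 1
    rw [Finset.mul_sum, Finset.mul_sum]
    refine Finset.sum_congr rfl fun m hm => ?_
    rw [hw m (Finset.mem_range.1 hm), hτp, Nat.add_sub_cancel,
      show ((m + 1 : ℕ) : ℝ) * τ - m * τ = τ by push_cast; ring]
    field_simp
  -- The cell m = p is excluded: it ends at the singularity s = t, where `0 ^ (-α)` is 0 and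
  -- monotonicity fails.
  have hkmono : ∀ m < p, MonotoneOn (fun s => (t - s) ^ (-α))
      (Icc ((m : ℝ) * τ) (((m + 1 : ℕ) : ℝ) * τ)) := by
    intro m hm x hx y hy hxy
    have h1 : ((m + 1 : ℕ) : ℝ) * τ ≤ p * τ :=
      mul_le_mul_of_nonneg_right (by exact_mod_cast hm) hτ.le
    exact Real.rpow_le_rpow_of_nonpos (by linarith [hy.2]) (by linarith) (by linarith)
  have hbound : |∑ m ∈ Finset.range (p + 1),
        ((g (((m + 1 : ℕ) : ℝ) * τ) - g (m * τ)) / (((m + 1 : ℕ) : ℝ) * τ - m * τ)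
            * (∫ s in (m : ℝ) * τ..((m + 1 : ℕ) : ℝ) * τ, (t - s) ^ (-α))
          - ∫ s in (m : ℝ) * τ..((m + 1 : ℕ) : ℝ) * τ, g' s * (t - s) ^ (-α))|
      ≤ L * (1 + 1 / (1 - α)) * τ ^ (2 - α) := by
    have hder : ∀ m < p + 1, ∀ s ∈ Icc ((m : ℝ) * τ) (((m + 1 : ℕ) : ℝ) * τ),
        HasDerivWithinAt g (g' s) (Icc ((m : ℝ) * τ) (((m + 1 : ℕ) : ℝ) * τ)) s :=
      fun m hm s hs => (hg s (hsub m hm hs)).mono (hsub m hm)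
    have hLip : ∀ m < p + 1, ∀ x ∈ Icc ((m : ℝ) * τ) (((m + 1 : ℕ) : ℝ) * τ),
        ∀ y ∈ Icc ((m : ℝ) * τ) (((m + 1 : ℕ) : ℝ) * τ), |g' x - g' y| ≤ L * |x - y| :=
      fun m hm x hx y hy => hL x (hsub m hm hx) y (hsub m hm hy)
    have hstep : ∀ m : ℕ, ((m + 1 : ℕ) : ℝ) * τ - m * τ = τ := fun m => by push_cast; ring
    refine (Finset.abs_sum_le_sum_abs _ _).trans ?_
    rw [Finset.sum_range_succ]
    have h1 : ∑ m ∈ Finset.range p,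
        |((g (((m + 1 : ℕ) : ℝ) * τ) - g (m * τ)) / (((m + 1 : ℕ) : ℝ) * τ - m * τ)
            * (∫ s in (m : ℝ) * τ..((m + 1 : ℕ) : ℝ) * τ, (t - s) ^ (-α))
          - ∫ s in (m : ℝ) * τ..((m + 1 : ℕ) : ℝ) * τ, g' s * (t - s) ^ (-α))|
        ≤ L * τ ^ 2 * τ ^ (-α) := by
      calc _ ≤ ∑ m ∈ Finset.range p, L * τ ^ 2 *
            ((t - ((m + 1 : ℕ) : ℝ) * τ) ^ (-α) - (t - (m : ℝ) * τ) ^ (-α)) := by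
            refine Finset.sum_le_sum fun m hm => ?_
            have hm' := Finset.mem_range.1 hm
            have := slope_kernel_bound_of_monotone (hlt m) (hder m (by omega)) (hLip m (by omega))
              hL0 (hkmono m hm')
            rwa [hstep] at this ⊢
        -- Telescoping leaves the kernel at distance τ from the singularity. This contributes the 1
        -- in 1 + 1/(1-α); the last cell contributes 1/(1-α).
        _ = L * τ ^ 2 * ((t - p * τ) ^ (-α) - (t - (0 : ℕ) * τ) ^ (-α)) := by
            rw [← Finset.mul_sum, Finset.sum_range_sub (fun m : ℕ => (t - (m : ℝ) * τ) ^ (-α))]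
        _ ≤ L * τ ^ 2 * τ ^ (-α) := by
            refine mul_le_mul_of_nonneg_left ?_ (by positivity)
            rw [show t - p * τ = τ by rw [ht']; ring]
            have : 0 ≤ (t - ((0 : ℕ) : ℝ) * τ) ^ (-α) := Real.rpow_nonneg (by simpa using ht0) _
            linarith
    have h2 := slope_kernel_bound (hlt p) (hder p (by omega)) (hLip p (by omega)) hL0
      (intervalIntegrable_kernel hα t _ _)
      (fun s hs => Real.rpow_nonneg (sub_nonneg.2 hs.2) _)
    rw [hw p (by omega), Nat.sub_self, l1Weight_zero hα, mul_one, hτp] at h2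
    refine (add_le_add h1 (h2.trans_eq' (by rw [hw p (by omega), Nat.sub_self, l1Weight_zero hα, mul_one, hτp]))).trans_eq ?_
    rw [hstep, hτ2]
    field_simp
  rw [hdiff, abs_mul, abs_of_pos (by positivity : 0 < 1 / Real.Gamma (1 - α))]
  calc _ ≤ 1 / Real.Gamma (1 - α) * (L * (1 + 1 / (1 - α)) * τ ^ (2 - α)) :=
        mul_le_mul_of_nonneg_left hbound (by positivity)
    _ = _ := by ring

/-! ### Polynomial approximation and regularity on the space-time rectangle. -/

theorem exists_antiderivative {n : ℕ} {q : ℝ[X]} (hq : q ∈ degreeLT ℝ n) :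
    ∃ Q ∈ degreeLT ℝ (n + 1), derivative Q = q := by
  refine ⟨∑ i ∈ Finset.range n, monomial (i + 1) (q.coeff i / (i + 1)),
    Submodule.sum_mem _ fun i hi => ?_, ?_⟩
  · rw [mem_degreeLT]
    refine (degree_monomial_le _ _).trans_lt ?_
    have := Finset.mem_range.1 hi
    exact_mod_cast (by omega : i + 1 < n + 1)
  · have hdeg : q = ∑ i ∈ Finset.range n, monomial i (q.coeff i) := by
      by_cases h0 : q = 0
      · simp [h0]
      · rw [mem_degreeLT, degree_eq_natDegree h0] at hq
        exact as_sum_range' q n (by exact_mod_cast hq)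
    conv_rhs => rw [hdeg]
    rw [derivative_sum]
    refine Finset.sum_congr rfl fun i _ => ?_
    rw [derivative_monomial, Nat.add_sub_cancel]
    congr 1
    have : (i : ℝ) + 1 ≠ 0 := by positivity
    push_cast
    field_simp

/-- Taylor approximation: a function with `n`-th derivative bounded by `B` is within
`B (r-l)^n` of a polynomial of degree less than `n`. -/
theorem exists_poly_approx {l r B : ℝ} (hlr : l < r) (n : ℕ) : ∀ G : ℕ → ℝ → ℝ,
    (∀ i < n, ∀ x ∈ Icc l r, HasDerivWithinAt (G i) (G (i + 1) x) (Icc l r) x) →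
    (∀ x ∈ Icc l r, |G n x| ≤ B) →
    ∃ q ∈ degreeLT ℝ n, ∀ x ∈ Icc l r, |G 0 x - q.eval x| ≤ B * (r - l) ^ n := by
  induction n with
  | zero =>
    intro G _ hB
    exact ⟨0, Submodule.zero_mem _, fun x hx => by simpa using hB x hx⟩
  | succ n ih =>
    intro G hG hB
    obtain ⟨q, hq, hqB⟩ := ih (fun i => G (i + 1)) (fun i hi => hG (i + 1) (by omega)) hB
    obtain ⟨Q, hQ, hQq⟩ := exists_antiderivative hq
    have hl : l ∈ Icc l r := left_mem_Icc.2 hlr.le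
    have hB0 : 0 ≤ B * (r - l) ^ n := (abs_nonneg _).trans (hqB l hl)
    -- The constant makes the error vanish at l, so the mean value inequality gains one factor r -
    -- l.
    refine ⟨Q + C (G 0 l - Q.eval l), Submodule.add_mem _ hQ ?_, fun x hx => ?_⟩
    · rw [mem_degreeLT]
      refine degree_C_le.trans_lt ?_
      exact_mod_cast Nat.succ_pos n
    · have h := (convex_Icc l r).norm_image_sub_le_of_norm_hasDerivWithin_le
        (f := fun y => G 0 y - Q.eval y) (f' := fun y => G 1 y - q.eval y)
        (fun y hy => (hG 0 (by omega) y hy).fun_sub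
          (by simpa [hQq] using (Q.hasDerivAt y).hasDerivWithinAt)) hqB hl hx
      simp only [Real.norm_eq_abs] at h
      rw [eval_add, eval_C, show G 0 x - (Q.eval x + (G 0 l - Q.eval l))
        = G 0 x - Q.eval x - (G 0 l - Q.eval l) by ring, pow_succ, ← mul_assoc]
      refine h.trans (mul_le_mul_of_nonneg_left ?_ hB0)
      rw [abs_of_nonneg (sub_nonneg.2 hx.1)]
      linarith [hx.2]

/-- Directional derivative within a set. -/
noncomputable def dirDeriv (S : Set (ℝ × ℝ)) (e : ℝ × ℝ) (F : ℝ × ℝ → ℝ) (z : ℝ × ℝ) : ℝ :=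
  fderivWithin ℝ F S z e

theorem dirDeriv_contDiffOn {S : Set (ℝ × ℝ)} (hS : UniqueDiffOn ℝ S) (e : ℝ × ℝ)
    {F : ℝ × ℝ → ℝ} {n : ℕ} (hF : ContDiffOn ℝ ((n + 1 : ℕ) : WithTop ℕ∞) F S) :
    ContDiffOn ℝ (n : WithTop ℕ∞) (dirDeriv S e F) S :=
  (hF.fderivWithin hS (m := (n : WithTop ℕ∞)) (by push_cast; exact le_rfl)).clm_apply
    contDiffOn_const

theorem dirDeriv_iterate_contDiffOn {S : Set (ℝ × ℝ)} (hS : UniqueDiffOn ℝ S) (e : ℝ × ℝ)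
    {F : ℝ × ℝ → ℝ} {n : ℕ} (i : ℕ) (hF : ContDiffOn ℝ ((n + i : ℕ) : WithTop ℕ∞) F S) :
    ContDiffOn ℝ (n : WithTop ℕ∞) ((dirDeriv S e)^[i] F) S := by
  induction i generalizing n with
  | zero => exact hF
  | succ i ih =>
    rw [Function.iterate_succ_apply']
    exact dirDeriv_contDiffOn hS e (ih (by rwa [show n + 1 + i = n + (i + 1) by omega]))

section Rectangle

variable {a b T : ℝ}

theorem uniqueDiffOn_rect (hab : a < b) (hT : 0 < T) :
    UniqueDiffOn ℝ (Icc a b ×ˢ Icc 0 T) :=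
  (uniqueDiffOn_Icc hab).prod (uniqueDiffOn_Icc hT)

theorem hasDerivWithinAt_fst {F : ℝ × ℝ → ℝ}
    (hF : DifferentiableOn ℝ F (Icc a b ×ˢ Icc 0 T)) {x t : ℝ} (hx : x ∈ Icc a b)
    (ht : t ∈ Icc 0 T) :
    HasDerivWithinAt (fun y => F (y, t)) (dirDeriv (Icc a b ×ˢ Icc 0 T) (1, 0) F (x, t))
      (Icc a b) x := by
  have h := (hF (x, t) ⟨hx, ht⟩).hasFDerivWithinAt
  have h2 : HasDerivWithinAt (fun y : ℝ => (y, t)) ((1 : ℝ), (0 : ℝ)) (Icc a b) x :=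
    (hasDerivWithinAt_id x _).prodMk (hasDerivWithinAt_const _ _ _)
  have hm : MapsTo (fun y : ℝ => (y, t)) (Icc a b) (Icc a b ×ˢ Icc 0 T) := fun y hy => ⟨hy, ht⟩
  exact h.comp_hasDerivWithinAt x h2 hm

theorem hasDerivWithinAt_snd {F : ℝ × ℝ → ℝ}
    (hF : DifferentiableOn ℝ F (Icc a b ×ˢ Icc 0 T)) {x t : ℝ} (hx : x ∈ Icc a b)
    (ht : t ∈ Icc 0 T) :
    HasDerivWithinAt (fun s => F (x, s)) (dirDeriv (Icc a b ×ˢ Icc 0 T) (0, 1) F (x, t))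
      (Icc 0 T) t := by
  have h := (hF (x, t) ⟨hx, ht⟩).hasFDerivWithinAt
  have h2 : HasDerivWithinAt (fun s : ℝ => (x, s)) ((0 : ℝ), (1 : ℝ)) (Icc 0 T) t :=
    (hasDerivWithinAt_const _ _ _).prodMk (hasDerivWithinAt_id t _)
  have hm : MapsTo (fun s : ℝ => (x, s)) (Icc 0 T) (Icc a b ×ˢ Icc 0 T) := fun s hs => ⟨hx, hs⟩
  exact h.comp_hasDerivWithinAt t h2 hm

theorem exists_bound_rect {F : ℝ × ℝ → ℝ} (hF : ContinuousOn F (Icc a b ×ˢ Icc 0 T)) :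
    ∃ B, 0 ≤ B ∧ ∀ x ∈ Icc a b, ∀ t ∈ Icc 0 T, |F (x, t)| ≤ B := by
  obtain ⟨B, hB⟩ := (isCompact_Icc.prod isCompact_Icc).exists_bound_of_continuousOn hF
  exact ⟨max B 0, le_max_right _ _, fun x hx t ht => (hB (x, t) ⟨hx, ht⟩).trans (le_max_left _ _)⟩

/-- A C¹ function on a compact convex set is Lipschitz. This stands in for bounds on one further
time derivative. -/
theorem exists_lipschitz_snd {F : ℝ × ℝ → ℝ}
    (hF : ContDiffOn ℝ ((1 : ℕ) : WithTop ℕ∞) F (Icc a b ×ˢ Icc 0 T)) :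
    ∃ L, 0 ≤ L ∧ ∀ x ∈ Icc a b, ∀ t ∈ Icc 0 T, ∀ s ∈ Icc 0 T,
      |F (x, t) - F (x, s)| ≤ L * |t - s| := by
  obtain ⟨K, hK⟩ := hF.exists_lipschitzOnWith (by simp)
    ((convex_Icc a b).prod (convex_Icc 0 T)) (isCompact_Icc.prod isCompact_Icc)
  refine ⟨K, K.2, fun x hx t ht s hs => ?_⟩
  have := hK.dist_le_mul (x, t) ⟨hx, ht⟩ (x, s) ⟨hx, hs⟩
  simpa [Prod.dist_eq, Real.dist_eq] using this

/-- Uniform spatial polynomial approximation of a smooth function on the rectangle. -/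
theorem exists_poly_approx_rect (hab : a < b) (hT : 0 < T) {F : ℝ × ℝ → ℝ} {n : ℕ}
    (hF : ContDiffOn ℝ (n : WithTop ℕ∞) F (Icc a b ×ˢ Icc 0 T)) :
    ∃ B, 0 ≤ B ∧ ∀ t ∈ Icc 0 T, ∀ l r, l < r → Icc l r ⊆ Icc a b →
      ∃ q ∈ degreeLT ℝ n, ∀ x ∈ Icc l r, |F (x, t) - q.eval x| ≤ B * (r - l) ^ n := by
  have hS := uniqueDiffOn_rect hab hT
  set S := Icc a b ×ˢ Icc 0 T with hSdef
  obtain ⟨B, hB0, hB⟩ := exists_bound_rect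
    (dirDeriv_iterate_contDiffOn hS (1, 0) (n := 0) n (by rwa [Nat.zero_add])).continuousOn
  refine ⟨B, hB0, fun t ht l r hlr hsub => ?_⟩
  refine exists_poly_approx hlr n (fun i x => (dirDeriv S (1, 0))^[i] F (x, t))
    (fun i hi x hx => ?_) (fun x hx => hB x (hsub hx) t ht)
  rw [Function.iterate_succ_apply']
  refine (hasDerivWithinAt_fst (ContDiffOn.differentiableOn (n := ((1 : ℕ) : WithTop ℕ∞))
    (dirDeriv_iterate_contDiffOn hS (1, 0) i (hF.of_le ?_)) (by simp)) (hsub hx) ht).mono hsub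
  exact_mod_cast (by omega : 1 + i ≤ n)

/-- Uniform spatial polynomial approximation of time increments of a smooth function. -/
theorem exists_poly_approx_increment (hab : a < b) (hT : 0 < T) {F : ℝ × ℝ → ℝ} {n : ℕ}
    (hF : ContDiffOn ℝ ((n + 1 : ℕ) : WithTop ℕ∞) F (Icc a b ×ˢ Icc 0 T)) :
    ∃ B, 0 ≤ B ∧ ∀ t ∈ Icc 0 T, ∀ s ∈ Icc 0 T, ∀ l r, l < r → Icc l r ⊆ Icc a b →
      ∃ q ∈ degreeLT ℝ n, ∀ x ∈ Icc l r,
        |F (x, t) - F (x, s) - q.eval x| ≤ B * |t - s| * (r - l) ^ n := by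
  have hS := uniqueDiffOn_rect hab hT
  set S := Icc a b ×ˢ Icc 0 T with hSdef
  -- After n space derivatives one order of smoothness is left, spent on the factor |t - s|. With n
  -- = k + 1 this uses all k + 2 derivatives.
  obtain ⟨B, hB0, hB⟩ := exists_lipschitz_snd
    (dirDeriv_iterate_contDiffOn hS (1, 0) (n := 1) n (by rwa [Nat.add_comm]))
  refine ⟨B, hB0, fun t ht s hs l r hlr hsub => ?_⟩
  refine exists_poly_approx hlr n
    (fun i x => (dirDeriv S (1, 0))^[i] F (x, t) - (dirDeriv S (1, 0))^[i] F (x, s))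
    (fun i hi x hx => ?_) (fun x hx => hB x (hsub hx) t ht s hs)
  simp only [Function.iterate_succ_apply']
  have hd := ContDiffOn.differentiableOn (n := ((1 : ℕ) : WithTop ℕ∞))
    (dirDeriv_iterate_contDiffOn hS (1, 0) i
      (hF.of_le (by exact_mod_cast (by omega : 1 + i ≤ n + 1)))) (by simp)
  exact ((hasDerivWithinAt_fst hd (hsub hx) ht).fun_sub
    (hasDerivWithinAt_fst hd (hsub hx) hs)).mono hsub

theorem deriv_weighted_eq {V : ℝ × ℝ → ℝ} (hV : DifferentiableOn ℝ V (Icc a b ×ˢ Icc 0 T))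
    {x s : ℝ} (hx : x ∈ Icc a b) (hs : s ∈ Ioo 0 T) :
    deriv (fun r => V (x, r)) s = dirDeriv (Icc a b ×ˢ Icc 0 T) (0, 1) V (x, s) :=
  ((hasDerivWithinAt_snd hV hx (Ioo_subset_Icc_self hs)).hasDerivAt
    (Icc_mem_nhds hs.1 hs.2)).deriv

/-- The weakly singular time integral depends continuously on the space variable. -/
theorem continuousOn_caputo {α : ℝ} (hα : α < 1) (hab : a < b) (hT : 0 < T) {V : ℝ × ℝ → ℝ}
    (hV : ContDiffOn ℝ ((1 : ℕ) : WithTop ℕ∞) V (Icc a b ×ˢ Icc 0 T)) {t : ℝ}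
    (ht : t ∈ Ioc 0 T) :
    ContinuousOn (fun x => ∫ s in (0 : ℝ)..t, deriv (fun r => V (x, r)) s / (t - s) ^ α)
      (Icc a b) := by
  have hS := uniqueDiffOn_rect hab hT
  have hd := hV.differentiableOn (by simp)
  set W := dirDeriv (Icc a b ×ˢ Icc 0 T) (0, 1) V with hW
  have hWc : ContinuousOn W (Icc a b ×ˢ Icc 0 T) :=
    (dirDeriv_contDiffOn hS (0, 1) (n := 0) hV).continuousOn
  obtain ⟨B, hB0, hB⟩ := exists_bound_rect hWc
  have hsub : uIcc 0 t ⊆ Icc 0 T := by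
    rw [uIcc_of_le ht.1.le]
    exact Icc_subset_Icc_right ht.2
  have hIoc : ∀ s ∈ uIoc 0 t, s ∈ Icc 0 T := fun s hs => hsub (uIoc_subset_uIcc hs)
  have heq : EqOn (fun x => ∫ s in (0 : ℝ)..t, deriv (fun r => V (x, r)) s / (t - s) ^ α)
      (fun x => ∫ s in (0 : ℝ)..t, W (x, s) * (t - s) ^ (-α)) (Icc a b) := by
    intro x hx
    refine intervalIntegral.integral_congr_Ioo_of_le ht.1.le fun s hs => ?_
    simp only [deriv_weighted_eq hd hx ⟨hs.1, hs.2.trans_le ht.2⟩,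
      Real.rpow_neg (sub_nonneg.2 hs.2.le), div_eq_mul_inv, hW]
  refine ContinuousOn.congr (fun x₀ hx₀ => ?_) heq
  -- Dominated convergence, with the integrable majorant B(t - s)^{-α} independent of x.
  refine intervalIntegral.continuousWithinAt_of_dominated_interval
    (bound := fun s => B * (t - s) ^ (-α)) ?_ ?_ ((intervalIntegrable_kernel hα t 0 t).const_mul B)
    ?_
  · filter_upwards [self_mem_nhdsWithin] with x hx
    refine (intervalIntegrable_iff.1 ?_).aestronglyMeasurable
    refine (intervalIntegrable_kernel hα t 0 t).continuousOn_mul ?_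
    exact hWc.comp (by fun_prop) fun s hs => ⟨hx, hsub hs⟩
  · filter_upwards [self_mem_nhdsWithin] with x hx
    refine Eventually.of_forall fun s hs => ?_
    have hs0 : 0 ≤ t - s := by
      rw [uIoc_of_le ht.1.le] at hs
      linarith [hs.2]
    rw [Real.norm_eq_abs, abs_mul, abs_of_nonneg (Real.rpow_nonneg hs0 _)]
    exact mul_le_mul_of_nonneg_right (hB x hx s (hIoc s hs)) (Real.rpow_nonneg hs0 _)
  · refine Eventually.of_forall fun s hs => ContinuousWithinAt.mul ?_ continuousWithinAt_const
    exact (hWc (x₀, s) ⟨hx₀, hIoc s hs⟩).comp (f := fun x => (x, s))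
      (by fun_prop) fun x hx => ⟨hx, hIoc s hs⟩

end Rectangle

/-! ### Discrete forms, flux cancellation, energy estimate and stability. -/

section

variable {a b : ℝ} {N : ℕ}

theorem pairing_comm (m : Mesh a b N) (v w : Fin N → ℝ[X]) : pairing m v w = pairing m w v := by
  simp only [pairing, mul_comm]

theorem pairing_self_nonneg (m : Mesh a b N) (v : Fin N → ℝ[X]) : 0 ≤ pairing m v v :=
  Finset.sum_nonneg fun j _ =>
    intervalIntegral.integral_nonneg (m.left_lt_right j).le fun _ _ => mul_self_nonneg _

theorem pairing_sub_left (m : Mesh a b N) (v v' w : Fin N → ℝ[X]) :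
    pairing m (fun j => v j - v' j) w = pairing m v w - pairing m v' w := by
  simp only [pairing, eval_sub, sub_mul, ← Finset.sum_sub_distrib]
  exact Finset.sum_congr rfl fun j _ => intervalIntegral.integral_sub
    (intervalIntegrable_poly_mul _ _ _ _) (intervalIntegrable_poly_mul _ _ _ _)

theorem pairingDeriv_sub_left (m : Mesh a b N) (v v' w : Fin N → ℝ[X]) :
    pairingDeriv m (fun j => v j - v' j) w = pairingDeriv m v w - pairingDeriv m v' w :=
  pairing_sub_left m v v' fun j => derivative (w j)

theorem pairing_C_mul_left (m : Mesh a b N) (c : ℝ) (v w : Fin N → ℝ[X]) :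
    pairing m (fun j => C c * v j) w = c * pairing m v w := by
  simp only [pairing, eval_mul, eval_C, mul_assoc, Finset.mul_sum,
    intervalIntegral.integral_const_mul]

theorem pairing_sum_left {ι : Type*} (m : Mesh a b N) (s : Finset ι) (v : ι → Fin N → ℝ[X])
    (w : Fin N → ℝ[X]) :
    pairing m (fun j => ∑ i ∈ s, v i j) w = ∑ i ∈ s, pairing m (v i) w := by
  simp only [pairing, eval_finsetSum, Finset.sum_mul]
  rw [Finset.sum_comm]
  exact Finset.sum_congr rfl fun j _ => intervalIntegral.integral_finsetSum
    fun i _ => intervalIntegrable_poly_mul _ _ _ _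

theorem fluxTerm_sub_left [NeZero N] (m : Mesh a b N) (δ : ℝ) (v v' w : Fin N → ℝ[X]) :
    fluxTerm m δ (fun j => v j - v' j) w = fluxTerm m δ v w - fluxTerm m δ v' w := by
  simp only [fluxTerm, weightedTrace, eval_sub, ← Finset.sum_sub_distrib]
  exact Finset.sum_congr rfl fun j _ => by ring

theorem mul_pairing_le (m : Mesh a b N) (s : ℝ) (v w : Fin N → ℝ[X]) :
    s * pairing m v w ≤ (s ^ 2 * pairing m v v + pairing m w w) / 2 := by
  have h := pairing_self_nonneg m fun j => C s * v j - w j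
  rw [pairing_sub_left, pairing_C_mul_left, pairing_comm m v, pairing_comm m w,
    pairing_sub_left, pairing_sub_left, pairing_C_mul_left, pairing_C_mul_left,
    pairing_comm m w v] at h
  nlinarith

/-- The generalized alternating fluxes cancel in the energy identity. -/
theorem flux_cancel [NeZero N] (m : Mesh a b N) (δ : ℝ) (v w : Fin N → ℝ[X]) :
    pairingDeriv m w v - fluxTerm m (1 - δ) w v
      + (pairingDeriv m v w - fluxTerm m δ v w) = 0 := by
  have hint : pairingDeriv m w v + pairingDeriv m v w
      = ∑ j, ((w j).eval (m.right j) * (v j).eval (m.right j)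
        - (w j).eval (m.left j) * (v j).eval (m.left j)) := by
    simp only [pairingDeriv, ← Finset.sum_add_distrib]
    refine Finset.sum_congr rfl fun j _ => ?_
    rw [← intervalIntegral.integral_add (intervalIntegrable_poly_mul _ _ _ _)
      (intervalIntegrable_poly_mul _ _ _ _)]
    rw [← eval_mul, ← eval_mul, ← intervalIntegral.integral_eq_sub_of_hasDerivAt
      (fun x _ => (w j * v j).hasDerivAt x) ((w j * v j).derivative.continuous.intervalIntegrable _ _)]
    refine intervalIntegral.integral_congr fun x _ => ?_
    simp only [derivative_mul, eval_add, eval_mul]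
    ring
  -- The cyclic shift regroups left-end contributions by node, so that both traces at a node meet in
  -- one summand.
  have hshift : ∀ F : Fin N → ℝ, ∑ j, F j = ∑ j, F (j + 1) := fun F =>
    (Equiv.sum_comp (Equiv.addRight (1 : Fin N)) F).symm
  have e1 : ∀ (δ : ℝ) (v w : Fin N → ℝ[X]), fluxTerm m δ v w
      = ∑ j, weightedTrace m δ v j
        * ((w j).eval (m.right j) - (w (j + 1)).eval (m.left (j + 1))) := by
    intro δ v w
    simp only [fluxTerm, Finset.sum_sub_distrib, mul_sub]
    congr 1
    rw [hshift]
    simp only [add_sub_cancel_right]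
  have e2 : pairingDeriv m w v + pairingDeriv m v w
      = ∑ j, ((w j).eval (m.right j) * (v j).eval (m.right j)
        - (w (j + 1)).eval (m.left (j + 1)) * (v (j + 1)).eval (m.left (j + 1))) := by
    rw [hint, Finset.sum_sub_distrib, Finset.sum_sub_distrib]
    congr 1
    exact hshift fun j => (w j).eval (m.left j) * (v j).eval (m.left j)
  -- At each node this is the product rule for jumps: w^{(1-δ)}(v⁻ - v⁺) + v^{(δ)}(w⁻ - w⁺) = v⁻w⁻ -
  -- v⁺w⁺.
  have e3 : fluxTerm m (1 - δ) w v + fluxTerm m δ v w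
      = pairingDeriv m w v + pairingDeriv m v w := by
    rw [e1, e1, e2, ← Finset.sum_add_distrib]
    refine Finset.sum_congr rfl fun j _ => ?_
    simp only [weightedTrace]
    ring
  linarith

theorem IsGaussRadauProj.weightedTrace_eq [NeZero N] {m : Mesh a b N} {k : ℕ} {δ : ℝ} {g : ℝ → ℝ}
    {P : Fin N → ℝ[X]} (h : IsGaussRadauProj m k δ g P) (hg : g a = g b) (j : Fin N) :
    weightedTrace m δ P j = g (m.right j) := by
  have h1 := h.trace j
  rw [m.periodic_node hg] at h1
  simp only [weightedTrace]
  linarith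

theorem derivative_mem_degreeLT {k : ℕ} {v : ℝ[X]} (hv : v ∈ degreeLT ℝ (k + 1)) :
    derivative v ∈ degreeLT ℝ k := by
  by_cases h0 : derivative v = 0
  · rw [h0]; exact Submodule.zero_mem _
  have hv0 : v ≠ 0 := by
    rintro rfl
    simp at h0
  rw [mem_degreeLT, degree_eq_natDegree hv0] at hv
  rw [mem_degreeLT, degree_eq_natDegree h0]
  have h1 : v.natDegree ≠ 0 := fun h => h0 (derivative_of_natDegree_zero h)
  have h2 := natDegree_derivative_lt h1
  have h3 : v.natDegree < k + 1 := by exact_mod_cast hv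
  exact_mod_cast (by omega : (derivative v).natDegree < k)

/-- The Gauss-Radau projection commutes with the weak derivative. -/
theorem IsGaussRadauProj.weak_derivative [NeZero N] {m : Mesh a b N} {k : ℕ} {δ : ℝ}
    {g g' : ℝ → ℝ} {P : Fin N → ℝ[X]} (h : IsGaussRadauProj m k δ g P) (hper : g a = g b)
    (hg : ∀ x ∈ Icc a b, HasDerivWithinAt g (g' x) (Icc a b) x) (hg' : ContinuousOn g' (Icc a b))
    {v : Fin N → ℝ[X]} (hv : v ∈ DGSpace N k) :
    pairingDeriv m P v - fluxTerm m δ P v = -load m g' v := by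
  have hgc : ContinuousOn g (Icc a b) := fun x hx => (hg x hx).continuousWithinAt
  have hleft : ∀ j : Fin N, g (m.right (j - 1)) = g (m.left j) := by
    intro j
    rw [← m.periodic_node hper, sub_add_cancel]
  simp only [pairingDeriv, fluxTerm, load, h.weightedTrace_eq hper, hleft,
    ← Finset.sum_sub_distrib, ← Finset.sum_neg_distrib]
  refine Finset.sum_congr rfl fun j _ => ?_
  -- Since v' has degree below k, P may be replaced by g in the volume term; the flux is already
  -- exact, so cellwise integration by parts finishes.
  have h1 := h.orthogonal j _ (derivative_mem_degreeLT (hv j))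
  rw [integral_poly_sub hgc] at h1
  have i1 := intervalIntegrable_cell hg' m j (v j)
  have i2 := intervalIntegrable_cell hgc m j (derivative (v j))
  have h2 := intervalIntegral.integral_eq_sub_of_hasDerivAt_of_le (m.left_lt_right j).le
    (f := fun x => g x * (v j).eval x)
    (f' := fun x => g' x * (v j).eval x + g x * (derivative (v j)).eval x)
    ((hgc.mono (m.Icc_subset j)).mul (v j).continuous.continuousOn)
    (fun x hx => ((hg x (m.Icc_subset j (Ioo_subset_Icc_self hx))).hasDerivAt
      (Icc_mem_nhds ((m.le_left j).trans_lt hx.1) (hx.2.trans_le (m.right_le j)))).fun_mul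
      ((v j).hasDerivAt x)) (i1.add i2)
  rw [intervalIntegral.integral_add i1 i2] at h2
  linarith

/-- `∑_j ∫ r_j v_j` for a function given cellwise. -/
noncomputable def cellLoad (m : Mesh a b N) (r : Fin N → ℝ → ℝ) (v : Fin N → ℝ[X]) : ℝ :=
  ∑ j, ∫ x in m.left j..m.right j, r j x * (v j).eval x

/-- Pointwise Young inequality rv ≤ εv² + r²/(4ε), integrated over the cells. -/
theorem cellLoad_le (m : Mesh a b N) {r : Fin N → ℝ → ℝ} {G ε : ℝ} (hε : 0 < ε)
    (hc : ∀ j, ContinuousOn (r j) (Icc (m.left j) (m.right j)))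
    (hr : ∀ j, ∀ x ∈ Icc (m.left j) (m.right j), |r j x| ≤ G) (v : Fin N → ℝ[X]) :
    cellLoad m r v ≤ ε * pairing m v v + G ^ 2 * (b - a) / (4 * ε) := by
  have e : ε * pairing m v v + G ^ 2 * (b - a) / (4 * ε)
      = ∑ j, ((ε * ∫ x in m.left j..m.right j, (v j).eval x * (v j).eval x)
        + G ^ 2 / (4 * ε) * (m.right j - m.left j)) := by
    rw [Finset.sum_add_distrib, ← Finset.mul_sum, ← Finset.mul_sum]
    have := m.sum_len
    simp only [Mesh.len] at this
    rw [this, pairing]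
    ring
  rw [e]
  refine Finset.sum_le_sum fun j _ => ?_
  have hle := (m.left_lt_right j).le
  have i1 := (intervalIntegrable_poly_mul (m.left j) (m.right j) (v j) (v j)).const_mul ε
  have e2 : (ε * ∫ x in m.left j..m.right j, (v j).eval x * (v j).eval x)
        + G ^ 2 / (4 * ε) * (m.right j - m.left j)
      = ∫ x in m.left j..m.right j, (ε * ((v j).eval x * (v j).eval x) + G ^ 2 / (4 * ε)) := by
    rw [intervalIntegral.integral_add i1 intervalIntegrable_const,
      intervalIntegral.integral_const_mul, intervalIntegral.integral_const, smul_eq_mul]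
    ring
  rw [e2]
  refine intervalIntegral.integral_mono_on hle ?_ (i1.add intervalIntegrable_const) fun x hx => ?_
  · refine ContinuousOn.intervalIntegrable ?_
    rw [uIcc_of_le hle]
    exact (hc j).mul (v j).continuous.continuousOn
  · have h1 : (r j x) ^ 2 ≤ G ^ 2 := by
      rw [← sq_abs]
      exact pow_le_pow_left₀ (abs_nonneg _) (hr j x hx) 2
    have h2 : 0 ≤ (2 * ε * (v j).eval x - r j x) ^ 2 := sq_nonneg _
    have h3 : G ^ 2 / (4 * ε) - ((r j x) * (v j).eval x - ε * ((v j).eval x * (v j).eval x))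
        = (G ^ 2 - (r j x) ^ 2 + (2 * ε * (v j).eval x - r j x) ^ 2) / (4 * ε) := by
      field_simp
      ring
    have h4 : 0 ≤ (G ^ 2 - (r j x) ^ 2 + (2 * ε * (v j).eval x - r j x) ^ 2) / (4 * ε) :=
      div_nonneg (by linarith) (by linarith)
    linarith

/-- The damped L1 difference of a sequence of piecewise polynomials. -/
noncomputable def l1Diff (α γ τ : ℝ) (P : ℕ → Fin N → ℝ[X]) (n : ℕ) (j : Fin N) : ℝ[X] :=
  P n j - (∑ i ∈ Finset.Icc 1 (n - 1),
      C ((l1Weight α (i - 1) - l1Weight α i) * Real.exp (-(i : ℝ) * γ * τ)) * P (n - i) j)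
    - C (l1Weight α (n - 1) * Real.exp (-(n : ℝ) * γ * τ)) * P 0 j

theorem pairing_l1Diff (m : Mesh a b N) (α γ τ : ℝ) (P : ℕ → Fin N → ℝ[X]) (n : ℕ)
    (v : Fin N → ℝ[X]) :
    pairing m (l1Diff α γ τ P n) v = pairing m (P n) v
      - (∑ i ∈ Finset.Icc 1 (n - 1), (l1Weight α (i - 1) - l1Weight α i)
          * Real.exp (-(i : ℝ) * γ * τ) * pairing m (P (n - i)) v
        + l1Weight α (n - 1) * Real.exp (-(n : ℝ) * γ * τ) * pairing m (P 0) v) := by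
  change pairing m (fun j => _ - _) v = _
  rw [pairing_sub_left, pairing_C_mul_left, pairing_sub_left, pairing_sum_left]
  simp only [pairing_C_mul_left]
  ring

/-- Since e^{-iγτ} = e^{-γt_n}e^{γt_{n-i}}, the damped difference is the undamped one conjugated by
e^{γt}. -/
theorem l1Diff_eval (α γ τ : ℝ) (P : ℕ → Fin N → ℝ[X]) (n : ℕ) (j : Fin N) (x : ℝ) :
    (l1Diff α γ τ P n j).eval x = Real.exp (-γ * (n * τ))
      * l1Op α (fun i => Real.exp (γ * (i * τ)) * (P i j).eval x) n := by
  have hmul : ∀ i : ℕ, i ≤ n → Real.exp (-γ * (n * τ)) * Real.exp (γ * (((n - i : ℕ) : ℝ) * τ))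
      = Real.exp (-(i : ℝ) * γ * τ) := by
    intro i hi
    rw [← Real.exp_add, Nat.cast_sub hi]
    congr 1
    ring
  have h0 := hmul 0 (Nat.zero_le _)
  have hn := hmul n le_rfl
  simp only [Nat.sub_zero, Nat.sub_self, Nat.cast_zero, neg_zero, zero_mul, Real.exp_zero] at h0 hn
  simp only [l1Diff, l1Op, eval_sub, eval_mul, eval_C, eval_finsetSum, mul_sub, Finset.mul_sum,
    Nat.cast_zero, zero_mul, mul_zero, Real.exp_zero, one_mul] at hn ⊢
  congr 1
  · congr 1
    · rw [← mul_assoc, h0, one_mul]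
    · refine Finset.sum_congr rfl fun i hi => ?_
      have hi' : i ≤ n := by
        have := (Finset.mem_Icc.1 hi).2
        omega
      rw [← hmul i hi']
      ring
  · rw [← hn]
    ring

theorem load_eq_cellLoad (m : Mesh a b N) (g : ℝ → ℝ) (v : Fin N → ℝ[X]) :
    load m g v = cellLoad m (fun _ => g) v := rfl

theorem pairing_eq_cellLoad (m : Mesh a b N) (P v : Fin N → ℝ[X]) :
    pairing m P v = cellLoad m (fun j x => (P j).eval x) v := rfl

theorem cellLoad_add (m : Mesh a b N) {r s : Fin N → ℝ → ℝ}
    (hr : ∀ j, ContinuousOn (r j) (Icc (m.left j) (m.right j)))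
    (hs : ∀ j, ContinuousOn (s j) (Icc (m.left j) (m.right j))) (c d : ℝ) (v : Fin N → ℝ[X]) :
    cellLoad m (fun j x => c * r j x + d * s j x) v = c * cellLoad m r v + d * cellLoad m s v := by
  have hi : ∀ {r : Fin N → ℝ → ℝ}, (∀ j, ContinuousOn (r j) (Icc (m.left j) (m.right j))) →
      ∀ j, IntervalIntegrable (fun x => r j x * (v j).eval x) volume (m.left j) (m.right j) := by
    intro r hr j
    refine ContinuousOn.intervalIntegrable ?_
    rw [uIcc_of_le (m.left_lt_right j).le]
    exact (hr j).mul (v j).continuous.continuousOn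
  simp only [cellLoad, Finset.mul_sum, ← Finset.sum_add_distrib]
  refine Finset.sum_congr rfl fun j _ => ?_
  simp only [add_mul, mul_assoc]
  rw [intervalIntegral.integral_add ((hi hr j).const_mul c) ((hi hs j).const_mul d),
    intervalIntegral.integral_const_mul, intervalIntegral.integral_const_mul]

theorem sub_mem_DGSpace {k : ℕ} {v w : Fin N → ℝ[X]} (hv : v ∈ DGSpace N k)
    (hw : w ∈ DGSpace N k) : (fun j => v j - w j) ∈ DGSpace N k :=
  fun j => Submodule.sub_mem _ (hv j) (hw j)

/-- Energy estimate for one time step of the error equation. -/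
theorem energy_step [NeZero N] {α γ ρ δ τ : ℝ} {k M : ℕ} {m : Mesh a b N} {f : ℝ → ℝ → ℝ}
    {u₀ : ℝ → ℝ} {uh ph : ℕ → Fin N → ℝ[X]}
    (h : IsLDGSolution α γ ρ δ τ k M m f u₀ uh ph) (hρ : 0 < ρ) {n : ℕ} (hn : 1 ≤ n) (hnM : n ≤ M)
    {P : ℕ → Fin N → ℝ[X]} {Q : Fin N → ℝ[X]} {z p q d : ℝ → ℝ}
    (hz : ContinuousOn z (Icc a b)) (hp : ContinuousOn p (Icc a b)) (hq : ContinuousOn q (Icc a b))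
    (hd : ContinuousOn d (Icc a b)) (hPm : P n ∈ DGSpace N k) (hQm : Q ∈ DGSpace N k)
    (hP : ∀ v ∈ DGSpace N k, pairingDeriv m (P n) v - fluxTerm m δ (P n) v = -load m p v)
    (hQ : ∀ v ∈ DGSpace N k, pairingDeriv m Q v - fluxTerm m (1 - δ) Q v = -load m q v)
    (hf : ∀ x ∈ Ioo a b, d x + ρ * z x - q x = f x (n * τ)) {G₁ G₂ : ℝ}
    (hG₁ : ∀ j, ∀ x ∈ Icc (m.left j) (m.right j),
      |ρ * ((P n j).eval x - z x) + (τ ^ (-α) / Real.Gamma (2 - α)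
        * (l1Diff α γ τ P n j).eval x - d x)| ≤ G₁)
    (hG₂ : ∀ j, ∀ x ∈ Icc (m.left j) (m.right j), |(Q j).eval x - p x| ≤ G₂) :
    (ρ + τ ^ (-α) / Real.Gamma (2 - α))
        * pairing m (fun j => P n j - uh n j) (fun j => P n j - uh n j)
      ≤ τ ^ (-α) / Real.Gamma (2 - α) *
          (∑ i ∈ Finset.Icc 1 (n - 1), (l1Weight α (i - 1) - l1Weight α i)
              * Real.exp (-(i : ℝ) * γ * τ)
              * pairing m (fun j => P (n - i) j - uh (n - i) j) (fun j => P n j - uh n j)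
            + l1Weight α (n - 1) * Real.exp (-(n : ℝ) * γ * τ)
              * pairing m (fun j => P 0 j - uh 0 j) (fun j => P n j - uh n j))
        + ρ / 2 * pairing m (fun j => P n j - uh n j) (fun j => P n j - uh n j)
        + (G₁ ^ 2 / (2 * ρ) + G₂ ^ 2 / 4) * (b - a) := by
  set c := τ ^ (-α) / Real.Gamma (2 - α) with hc
  set v : Fin N → ℝ[X] := fun j => P n j - uh n j with hv
  set ζ : Fin N → ℝ[X] := fun j => Q j - ph n j with hζ
  have hvm : v ∈ DGSpace N k := sub_mem_DGSpace hPm (h.mem_u n hn hnM)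
  have hζm : ζ ∈ DGSpace N k := sub_mem_DGSpace hQm (h.mem_p n hn hnM)
  have s1 := h.scheme_u n hn hnM v hvm
  have s2 := h.scheme_p n hn hnM ζ hζm
  have c1 := hQ v hvm
  have c2 := hP ζ hζm
  have fc := flux_cancel m δ v ζ
  have d1 : pairingDeriv m ζ v = _ := pairingDeriv_sub_left m Q (ph n) v
  have d2 : pairingDeriv m v ζ = _ := pairingDeriv_sub_left m (P n) (uh n) ζ
  have d3 : fluxTerm m (1 - δ) ζ v = _ := fluxTerm_sub_left m (1 - δ) Q (ph n) v
  have d4 : fluxTerm m δ v ζ = _ := fluxTerm_sub_left m δ (P n) (uh n) ζ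
  have p1 : pairing m v v = _ := pairing_sub_left m (P n) (uh n) v
  have p2 : pairing m ζ ζ = _ := pairing_sub_left m Q (ph n) ζ
  have hsum := pairing_l1Diff m α γ τ P n v
  have cont : ∀ {g : ℝ → ℝ}, ContinuousOn g (Icc a b) →
      ∀ j : Fin N, ContinuousOn g (Icc (m.left j) (m.right j)) :=
    fun hg j => hg.mono (m.Icc_subset j)
  have contP : ∀ (W : Fin N → ℝ[X]) (j : Fin N),
      ContinuousOn (fun x => (W j).eval x) (Icc (m.left j) (m.right j)) :=
    fun W j => (W j).continuous.continuousOn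
  have hload : load m (fun x => f x (n * τ)) v
      = load m d v + ρ * load m z v - load m q v := by
    have e : load m (fun x => f x (n * τ)) v
        = cellLoad m (fun _ x => 1 * (1 * d x + ρ * z x) + (-1) * q x) v := by
      refine Finset.sum_congr rfl fun j _ => ?_
      refine intervalIntegral.integral_congr_Ioo_of_le (m.left_lt_right j).le fun x hx => ?_
      simp only [← hf x ⟨(m.le_left j).trans_lt hx.1, hx.2.trans_le (m.right_le j)⟩]
      ring
    rw [e, cellLoad_add m (r := fun _ x => 1 * d x + ρ * z x) (s := fun _ => q)
      (fun j => (continuousOn_const.mul (cont hd j)).add (continuousOn_const.mul (cont hz j)))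
      (cont hq), cellLoad_add m (r := fun _ => d) (s := fun _ => z) (cont hd) (cont hz)]
    simp only [load_eq_cellLoad]
    ring
  have hR : cellLoad m (fun j x => ρ * ((P n j).eval x - z x)
        + (c * (l1Diff α γ τ P n j).eval x - d x)) v
      = ρ * (pairing m (P n) v - load m z v) + (c * pairing m (l1Diff α γ τ P n) v - load m d v) := by
    have e : (fun (j : Fin N) x => ρ * ((P n j).eval x - z x)
        + (c * (l1Diff α γ τ P n j).eval x - d x))
        = fun j x => 1 * (ρ * (P n j).eval x + (-ρ) * z x)
          + 1 * (c * (l1Diff α γ τ P n j).eval x + (-1) * d x) := by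
      funext j x
      ring
    rw [e, cellLoad_add m (r := fun j x => ρ * (P n j).eval x + (-ρ) * z x)
      (s := fun j x => c * (l1Diff α γ τ P n j).eval x + (-1) * d x)
      (fun j => (continuousOn_const.mul (contP _ j)).add (continuousOn_const.mul (cont hz j)))
      (fun j => (continuousOn_const.mul (contP _ j)).add (continuousOn_const.mul (cont hd j))),
      cellLoad_add m (r := fun j x => (P n j).eval x) (s := fun _ => z) (contP _) (cont hz),
      cellLoad_add m (r := fun j x => (l1Diff α γ τ P n j).eval x) (s := fun _ => d)
        (contP _) (cont hd)]
    simp only [load_eq_cellLoad, pairing_eq_cellLoad]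
    ring
  have hE : cellLoad m (fun j x => (Q j).eval x - p x) ζ = pairing m Q ζ - load m p ζ := by
    have e : (fun (j : Fin N) x => (Q j).eval x - p x)
        = fun j x => 1 * (Q j).eval x + (-1) * p x := by
      funext j x
      ring
    rw [e, cellLoad_add m (r := fun j x => (Q j).eval x) (s := fun _ => p) (contP _) (cont hp)]
    simp only [load_eq_cellLoad, pairing_eq_cellLoad]
    ring
  -- Young with ε = ρ/2 here leaves half of the reaction term on the left; with ε = 1 below it
  -- exactly absorbs ‖ζ‖².
  have y1 := cellLoad_le m
    (r := fun j x => ρ * ((P n j).eval x - z x) + (c * (l1Diff α γ τ P n j).eval x - d x))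
    (half_pos hρ) (fun j => ContinuousOn.add
    (continuousOn_const.mul ((contP (P n) j).sub (cont hz j)))
    ((continuousOn_const.mul (contP (l1Diff α γ τ P n) j)).sub (cont hd j))) hG₁ v
  have y2 := cellLoad_le m (r := fun j x => (Q j).eval x - p x) one_pos (fun j => (contP Q j).sub (cont hp j)) hG₂ ζ
  rw [hR] at y1
  rw [hE] at y2
  have hS : (∑ i ∈ Finset.Icc 1 (n - 1), (l1Weight α (i - 1) - l1Weight α i)
              * Real.exp (-(i : ℝ) * γ * τ)
              * pairing m (fun j => P (n - i) j - uh (n - i) j) v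
            + l1Weight α (n - 1) * Real.exp (-(n : ℝ) * γ * τ)
              * pairing m (fun j => P 0 j - uh 0 j) v)
      = (∑ i ∈ Finset.Icc 1 (n - 1), (l1Weight α (i - 1) - l1Weight α i)
          * Real.exp (-(i : ℝ) * γ * τ) * pairing m (P (n - i)) v
        + l1Weight α (n - 1) * Real.exp (-(n : ℝ) * γ * τ) * pairing m (P 0) v)
        - (∑ i ∈ Finset.Icc 1 (n - 1), (l1Weight α (i - 1) - l1Weight α i)
          * Real.exp (-(i : ℝ) * γ * τ) * pairing m (uh (n - i)) v
        + l1Weight α (n - 1) * Real.exp (-(n : ℝ) * γ * τ) * pairing m (uh 0) v) := by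
    simp only [pairing_sub_left, mul_sub, Finset.sum_sub_distrib]
    ring
  rw [hS]
  set SP := ∑ i ∈ Finset.Icc 1 (n - 1), (l1Weight α (i - 1) - l1Weight α i)
          * Real.exp (-(i : ℝ) * γ * τ) * pairing m (P (n - i)) v
        + l1Weight α (n - 1) * Real.exp (-(n : ℝ) * γ * τ) * pairing m (P 0) v with hSP
  set SU := ∑ i ∈ Finset.Icc 1 (n - 1), (l1Weight α (i - 1) - l1Weight α i)
          * Real.exp (-(i : ℝ) * γ * τ) * pairing m (uh (n - i)) v
        + l1Weight α (n - 1) * Real.exp (-(n : ℝ) * γ * τ) * pairing m (uh 0) v with hSU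
  rw [hload] at s1
  -- The sum of the two tested error equations: the coupling terms in v and ζ disappear through
  -- `flux_cancel`, those of the projections through `c1` and `c2`.
  have hid : (ρ + c) * pairing m v v + pairing m ζ ζ = c * (SP - SU)
      + (ρ * (pairing m (P n) v - load m z v) + (c * pairing m (l1Diff α γ τ P n) v - load m d v))
      + (pairing m Q ζ - load m p ζ) := by
    rw [hsum]
    linear_combination (ρ + c) * p1 + p2 - s1 - s2 + c1 + c2 - fc + d1 + d2 - d3 - d4
  have e4 : G₁ ^ 2 * (b - a) / (4 * (ρ / 2)) = G₁ ^ 2 / (2 * ρ) * (b - a) := by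
    field_simp
    ring
  linarith

/-- Unconditional stability of the damped L1 recursion. -/
theorem l1_stability (m : Mesh a b N) {α γ τ ρ c K : ℝ} (hα₀ : 0 < α) (hα : α < 1) (hρ : 0 < ρ)
    (hc : 0 ≤ c) (hK : 0 ≤ K) {M : ℕ} {ξ : ℕ → Fin N → ℝ[X]} (h0 : pairing m (ξ 0) (ξ 0) = 0)
    {κ : ℝ} (hκ : ∀ n ≤ M, Real.exp (2 * γ * (n * τ)) * κ ≤ K)
    (h : ∀ n, 1 ≤ n → n ≤ M → (ρ + c) * pairing m (ξ n) (ξ n)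
      ≤ c * (∑ i ∈ Finset.Icc 1 (n - 1), (l1Weight α (i - 1) - l1Weight α i)
              * Real.exp (-(i : ℝ) * γ * τ) * pairing m (ξ (n - i)) (ξ n)
            + l1Weight α (n - 1) * Real.exp (-(n : ℝ) * γ * τ) * pairing m (ξ 0) (ξ n))
        + ρ / 2 * pairing m (ξ n) (ξ n) + κ) :
    ∀ n ≤ M, Real.exp (2 * γ * (n * τ)) * pairing m (ξ n) (ξ n) ≤ 2 * K / ρ := by
  have hB : 0 ≤ 2 * K / ρ := by positivity
  intro n
  induction n using Nat.strong_induction_on with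
  | _ n ih =>
    intro hnM
    rcases Nat.eq_zero_or_pos n with rfl | hn
    · rw [h0, mul_zero]
      exact hB
    set E := Real.exp (2 * γ * (n * τ)) with hE
    have hE0 : 0 < E := Real.exp_pos _
    set y := E * pairing m (ξ n) (ξ n) with hy
    set B := 2 * K / ρ with hBdef
    have hterm : ∀ i, 1 ≤ i → i ≤ n →
        E * (Real.exp (-(i : ℝ) * γ * τ) * pairing m (ξ (n - i)) (ξ n)) ≤ (B + y) / 2 := by
      intro i hi hin
      have h1 := mul_pairing_le m (Real.exp (-(i : ℝ) * γ * τ)) (ξ (n - i)) (ξ n)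
      have h2 := ih (n - i) (by omega) (by omega)
      -- The squared damping factor turns the weight at t_n into the weight at t_{n-i}, so the
      -- induction hypothesis applies.
      have h3 : E * Real.exp (-(i : ℝ) * γ * τ) ^ 2 = Real.exp (2 * γ * (((n - i : ℕ) : ℝ) * τ)) := by
        rw [hE, ← Real.exp_nat_mul, ← Real.exp_add, Nat.cast_sub hin]
        congr 1
        push_cast
        ring
      rw [← h3] at h2
      have h4 := mul_le_mul_of_nonneg_left h1 hE0.le
      rw [hy]
      linarith
    have hsum : E * (∑ i ∈ Finset.Icc 1 (n - 1), (l1Weight α (i - 1) - l1Weight α i)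
              * Real.exp (-(i : ℝ) * γ * τ) * pairing m (ξ (n - i)) (ξ n)
            + l1Weight α (n - 1) * Real.exp (-(n : ℝ) * γ * τ) * pairing m (ξ 0) (ξ n))
        ≤ (B + y) / 2 := by
      calc _ = ∑ i ∈ Finset.Icc 1 (n - 1), (l1Weight α (i - 1) - l1Weight α i)
              * (E * (Real.exp (-(i : ℝ) * γ * τ) * pairing m (ξ (n - i)) (ξ n)))
            + l1Weight α (n - 1)
              * (E * (Real.exp (-(n : ℝ) * γ * τ) * pairing m (ξ (n - n)) (ξ n))) := by
            rw [mul_add, Finset.mul_sum, Nat.sub_self]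
            congr 1
            · exact Finset.sum_congr rfl fun i _ => by ring
            · ring
        _ ≤ ∑ i ∈ Finset.Icc 1 (n - 1), (l1Weight α (i - 1) - l1Weight α i) * ((B + y) / 2)
            + l1Weight α (n - 1) * ((B + y) / 2) := by
            refine add_le_add (Finset.sum_le_sum fun i hi => ?_) ?_
            · have hi' := Finset.mem_Icc.1 hi
              exact mul_le_mul_of_nonneg_left (hterm i hi'.1 (by omega))
                (l1Weight_sub_nonneg hα₀ hα hi'.1)
            · exact mul_le_mul_of_nonneg_left (hterm n hn le_rfl) (l1Weight_nonneg hα _)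
        _ = (B + y) / 2 := by
            rw [← Finset.sum_mul, ← add_mul, sum_l1Weight_sub hα, one_mul]
    have hstep := mul_le_mul_of_nonneg_left (h n hn hnM) hE0.le
    have hκn := hκ n hnM
    have hKB : K = ρ * B / 2 := by
      rw [hBdef]
      field_simp
    have h5 := mul_le_mul_of_nonneg_left hsum hc
    -- B = 2K/ρ is the fixed point of the recursion: (ρ + c)y ≤ c(B + y)/2 + ρy/2 + ρB/2.
    have h6 : (ρ / 2 + c / 2) * y ≤ (ρ / 2 + c / 2) * B := by
      rw [hKB] at hκn
      rw [hy] at h5 ⊢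
      nlinarith
    exact le_of_mul_le_mul_left h6 (by positivity)

/-- Triangle inequality for the squared `L²` error. -/
theorem sum_integral_sq_le (m : Mesh a b N) {z : ℝ → ℝ} (hz : ContinuousOn z (Icc a b))
    {P W : Fin N → ℝ[X]} {G : ℝ}
    (hG : ∀ j, ∀ x ∈ Icc (m.left j) (m.right j), |(P j).eval x - z x| ≤ G) :
    ∑ j, ∫ x in m.left j..m.right j, (z x - (W j).eval x) ^ 2
      ≤ 2 * G ^ 2 * (b - a) + 2 * pairing m (fun j => P j - W j) (fun j => P j - W j) := by
  have e : 2 * G ^ 2 * (b - a) + 2 * pairing m (fun j => P j - W j) (fun j => P j - W j)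
      = ∑ j, (2 * G ^ 2 * (m.right j - m.left j)
        + 2 * ∫ x in m.left j..m.right j, (P j - W j).eval x * (P j - W j).eval x) := by
    rw [Finset.sum_add_distrib, ← Finset.mul_sum, ← Finset.mul_sum]
    have := m.sum_len
    simp only [Mesh.len] at this
    rw [this, pairing]
  rw [e]
  refine Finset.sum_le_sum fun j _ => ?_
  have hle := (m.left_lt_right j).le
  have i1 := (intervalIntegrable_poly_mul (m.left j) (m.right j) (P j - W j) (P j - W j)).const_mul 2
  have e2 : 2 * G ^ 2 * (m.right j - m.left j)
        + 2 * ∫ x in m.left j..m.right j, (P j - W j).eval x * (P j - W j).eval x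
      = ∫ x in m.left j..m.right j,
        (2 * G ^ 2 + 2 * ((P j - W j).eval x * (P j - W j).eval x)) := by
    rw [intervalIntegral.integral_add intervalIntegrable_const i1, intervalIntegral.integral_const,
      intervalIntegral.integral_const_mul, smul_eq_mul]
    ring
  rw [e2]
  refine intervalIntegral.integral_mono_on hle ?_ (intervalIntegrable_const.add i1) fun x hx => ?_
  · refine ContinuousOn.intervalIntegrable ?_
    rw [uIcc_of_le hle]
    exact ((hz.mono (m.Icc_subset j)).sub (W j).continuous.continuousOn).pow 2
  · have h1 : ((P j).eval x - z x) ^ 2 ≤ G ^ 2 := by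
      rw [← sq_abs]
      exact pow_le_pow_left₀ (abs_nonneg _) (hG j x hx) 2
    rw [eval_sub]
    nlinarith [sq_nonneg ((z x - (P j).eval x) - ((P j).eval x - (W j).eval x))]

end

/-! ### Uniform consistency bounds and assembly of the error estimate. -/

/-- Optimal pointwise accuracy of the generalized Gauss-Radau projection. -/
theorem gaussRadau_accuracy (k : ℕ) {δ : ℝ} (hδ : δ ≠ 1 / 2) : ∃ K : ℝ, 0 ≤ K ∧
    ∀ {a b : ℝ} {N : ℕ} [NeZero N] (m : Mesh a b N) (g : ℝ → ℝ) (B : ℝ),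
    ContinuousOn g (Icc a b) → 0 ≤ B →
    (∀ l r, l < r → Icc l r ⊆ Icc a b →
      ∃ q ∈ degreeLT ℝ (k + 1), ∀ x ∈ Icc l r, |g x - q.eval x| ≤ B * (r - l) ^ (k + 1)) →
    (∃ P, IsGaussRadauProj m k δ g P) ∧ ∀ P, IsGaussRadauProj m k δ g P →
      ∀ j, ∀ x ∈ Icc (m.left j) (m.right j),
        |(P j).eval x - g x| ≤ K * B * m.size ^ (k + 1) := by
  obtain ⟨K, hK0, hK⟩ := exists_gaussRadau_bound k hδ
  refine ⟨K, hK0, fun {a b N} _ m g B hg hB happ => ?_⟩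
  obtain ⟨P, hP, hPb⟩ := hK m g (B * m.size ^ (k + 1)) hg fun j => by
    obtain ⟨q, hq, hqb⟩ := happ _ _ (m.left_lt_right j) (m.Icc_subset j)
    refine ⟨q, hq, fun x hx => (hqb x hx).trans (mul_le_mul_of_nonneg_left ?_ hB)⟩
    exact pow_le_pow_left₀ (sub_pos.2 (m.left_lt_right j)).le (m.len_le_size j) _
  refine ⟨⟨P, hP⟩, fun P' hP' j x hx => ?_⟩
  rw [hP'.unique hδ hg hP, mul_assoc]
  exact hPb j x hx

theorem l1Op_sub (α : ℝ) (y z : ℕ → ℝ) (n : ℕ) :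
    l1Op α (fun i => y i - z i) n = l1Op α y n - l1Op α z n := by
  simp only [l1Op, mul_sub, Finset.sum_sub_distrib]
  ring

theorem exp_mul_le {γ t T : ℝ} (c : ℝ) (hc : 0 ≤ c) (ht : t ∈ Icc 0 T) :
    Real.exp (c * γ * t) ≤ Real.exp (c * |γ| * T) := by
  refine Real.exp_le_exp.2 ?_
  have h1 : γ * t ≤ |γ| * T :=
    (mul_le_mul_of_nonneg_right (le_abs_self γ) ht.1).trans
      (mul_le_mul_of_nonneg_left ht.2 (abs_nonneg γ))
  nlinarith

/-- Consistency of the damped L1 formula, uniformly in space. -/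
theorem exists_l1_consistency {α γ a b T : ℝ} (hα₀ : 0 < α) (hα : α < 1) (hab : a < b)
    (hT : 0 < T) {u : ℝ → ℝ → ℝ}
    (hV : ContDiffOn ℝ ((2 : ℕ) : WithTop ℕ∞) (fun z : ℝ × ℝ => Real.exp (γ * z.2) * u z.1 z.2)
      (Icc a b ×ˢ Icc 0 T)) :
    ∃ K : ℝ, 0 ≤ K ∧ ∀ x ∈ Icc a b, ∀ τ : ℝ, 0 < τ → ∀ n : ℕ, 1 ≤ n → n * τ ≤ T →
      |τ ^ (-α) / Real.Gamma (2 - α) * (Real.exp (-γ * (n * τ))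
          * l1Op α (fun i => Real.exp (γ * (i * τ)) * u x (i * τ)) n)
        - temperedCaputo α γ (fun s => u x s) (n * τ)| ≤ K * τ ^ (2 - α) := by
  set V : ℝ × ℝ → ℝ := fun z => Real.exp (γ * z.2) * u z.1 z.2 with hVdef
  have hS := uniqueDiffOn_rect hab hT
  obtain ⟨L, hL0, hL⟩ := exists_lipschitz_snd (dirDeriv_contDiffOn hS (0, 1) (n := 1) hV)
  have hΓ : 0 < Real.Gamma (1 - α) := Real.Gamma_pos_of_pos (by linarith)
  have hα' : 0 < 1 - α := by linarith
  set A := L * (1 + 1 / (1 - α)) / Real.Gamma (1 - α) with hA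
  have hA0 : 0 ≤ A := by positivity
  refine ⟨Real.exp (1 * |γ| * T) * A, by positivity, fun x hx τ hτ n hn hnT => ?_⟩
  have hn0 : 0 ≤ n * τ := by positivity
  have hsub : Icc 0 (n * τ) ⊆ Icc 0 T := Icc_subset_Icc_right hnT
  have h := l1_truncation hα₀ hα hτ hn (g := fun s => V (x, s)) hL0
    (fun s hs => (hasDerivWithinAt_snd (hV.differentiableOn (by simp)) hx (hsub hs)).mono hsub)
    (fun s hs r hr => hL x hx s (hsub hs) r (hsub hr))
  have hexp : Real.exp (-γ * (n * τ)) ≤ Real.exp (1 * |γ| * T) := by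
    have := exp_mul_le (γ := -γ) 1 zero_le_one ⟨hn0, hnT⟩
    rwa [abs_neg, one_mul] at this
  have e : τ ^ (-α) / Real.Gamma (2 - α) * (Real.exp (-γ * (n * τ))
          * l1Op α (fun i => Real.exp (γ * (i * τ)) * u x (i * τ)) n)
        - temperedCaputo α γ (fun s => u x s) (n * τ)
      = Real.exp (-γ * (n * τ)) * (τ ^ (-α) / Real.Gamma (2 - α) * l1Op α (fun m => V (x, m * τ)) n
        - 1 / Real.Gamma (1 - α)
          * ∫ s in (0 : ℝ)..n * τ, deriv (fun s => V (x, s)) s / (n * τ - s) ^ α) := by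
    simp only [temperedCaputo, hVdef]
    ring
  rw [e, abs_mul, abs_of_pos (Real.exp_pos _), mul_assoc]
  exact mul_le_mul hexp h (abs_nonneg _) (Real.exp_pos _).le

/-- The damped L1 formula of the projection error is small. -/
theorem abs_l1_projection_error_le {α γ τ T A : ℝ} (hα : α < 1) (hτ : 0 < τ) {n : ℕ} (hn : 1 ≤ n)
    (hnT : n * τ ≤ T) {y : ℕ → ℝ} (hA : 0 ≤ A) (hy : ∀ i < n, |y (i + 1) - y i| ≤ A * τ) :
    |τ ^ (-α) / Real.Gamma (2 - α) * (Real.exp (-γ * (n * τ)) * l1Op α y n)|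
      ≤ Real.exp (1 * |γ| * T) * A * T ^ (1 - α) / Real.Gamma (2 - α) := by
  have hΓ : 0 < Real.Gamma (2 - α) := Real.Gamma_pos_of_pos (by linarith)
  have hn0 : 0 ≤ n * τ := by positivity
  have hexp : Real.exp (-γ * (n * τ)) ≤ Real.exp (1 * |γ| * T) := by
    have := exp_mul_le (γ := -γ) 1 zero_le_one ⟨hn0, hnT⟩
    rwa [abs_neg, one_mul] at this
  have h1 := abs_l1Op_le hα hn hy
  have hτp : τ ^ (-α) * τ = τ ^ (1 - α) := by
    rw [sub_eq_add_neg, Real.rpow_add hτ, Real.rpow_one, mul_comm]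
  -- The singular τ^{-α} is compensated by the increment size τ and the weight sum n^{1-α}: together
  -- they are (nτ)^{1-α}.
  have h2 : (n * τ) ^ (1 - α) ≤ T ^ (1 - α) := Real.rpow_le_rpow hn0 hnT (by linarith)
  rw [Real.mul_rpow (by positivity) hτ.le, ← hτp] at h2
  have hc : 0 < τ ^ (-α) := Real.rpow_pos_of_pos hτ _
  rw [abs_mul, abs_mul, abs_of_pos (Real.exp_pos _), abs_of_pos (by positivity)]
  calc τ ^ (-α) / Real.Gamma (2 - α) * (Real.exp (-γ * (n * τ)) * |l1Op α y n|)
      ≤ τ ^ (-α) / Real.Gamma (2 - α)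
          * (Real.exp (1 * |γ| * T) * (A * τ * (n : ℝ) ^ (1 - α))) := by gcongr
    _ = Real.exp (1 * |γ| * T) * A / Real.Gamma (2 - α)
          * ((n : ℝ) ^ (1 - α) * (τ ^ (-α) * τ)) := by ring
    _ ≤ Real.exp (1 * |γ| * T) * A / Real.Gamma (2 - α) * T ^ (1 - α) := by gcongr
    _ = _ := by ring

section ExactSolution

variable {a b T : ℝ}

/-- The equation uses two-sided derivatives, which agree with the one-sided ones of the rectangle at
interior points x. -/
theorem iteratedDeriv_two_eq (hab : a < b) (hT : 0 < T) {F : ℝ × ℝ → ℝ}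
    (hF : ContDiffOn ℝ ((2 : ℕ) : WithTop ℕ∞) F (Icc a b ×ˢ Icc 0 T)) {x t : ℝ}
    (hx : x ∈ Ioo a b) (ht : t ∈ Icc 0 T) :
    iteratedDeriv 2 (fun y => F (y, t)) x
      = dirDeriv (Icc a b ×ˢ Icc 0 T) (1, 0) (dirDeriv (Icc a b ×ˢ Icc 0 T) (1, 0) F) (x, t) := by
  have hS := uniqueDiffOn_rect hab hT
  set S := Icc a b ×ˢ Icc 0 T with hSdef
  have h1 : ∀ y ∈ Ioo a b, deriv (fun y => F (y, t)) y = dirDeriv S (1, 0) F (y, t) := fun y hy =>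
    ((hasDerivWithinAt_fst (hF.differentiableOn (by simp)) (Ioo_subset_Icc_self hy) ht).hasDerivAt
      (Icc_mem_nhds hy.1 hy.2)).deriv
  have h2 := (hasDerivWithinAt_fst ((dirDeriv_contDiffOn hS (1, 0) (n := 1) hF).differentiableOn
    (by simp)) (Ioo_subset_Icc_self hx) ht).hasDerivAt (Icc_mem_nhds hx.1 hx.2)
  rw [iteratedDeriv_succ, iteratedDeriv_one, ← h2.deriv]
  refine EventuallyEq.deriv_eq ?_
  filter_upwards [Ioo_mem_nhds hx.1 hx.2] with y hy using h1 y hy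

theorem continuousOn_slice {F : ℝ × ℝ → ℝ} (hF : ContinuousOn F (Icc a b ×ˢ Icc 0 T)) {t : ℝ}
    (ht : t ∈ Icc 0 T) : ContinuousOn (fun x => F (x, t)) (Icc a b) :=
  hF.comp (f := fun x => (x, t)) (by fun_prop) fun _ hx => ⟨hx, ht⟩

end ExactSolution

/-- The error estimate for a time step `τ` with `M τ ≤ T`. -/
theorem exists_error_bound {α γ ρ a b T δ : ℝ} {k : ℕ}
    (hα₀ : 0 < α) (hα₁ : α < 1) (hρ : 0 < ρ) (hab : a < b) (hT : 0 < T) (hδ : δ ≠ 1 / 2)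
    {f : ℝ → ℝ → ℝ} {u₀ : ℝ → ℝ} {u : ℝ → ℝ → ℝ}
    (hu : IsExactSolution α γ ρ a b T f u₀ u)
    (hsmooth : ContDiffOn ℝ ((k + 2 : ℕ) : WithTop ℕ∞) (Function.uncurry u)
      (Icc a b ×ˢ Icc 0 T)) :
    ∃ C : ℝ, 0 < C ∧ ∀ (N : ℕ) [NeZero N] (m : Mesh a b N) (M : ℕ) (τ : ℝ), 0 < τ →
      M * τ ≤ T → ∀ (uh ph : ℕ → Fin N → ℝ[X]),
        IsLDGSolution α γ ρ δ τ k M m f u₀ uh ph →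
      ∀ n : ℕ, n ≤ M →
        l2Error m (fun x => u x (n * τ)) (uh n) ≤ C * (m.size ^ (k + 1) + τ ^ (2 - α)) := by
  have hS := uniqueDiffOn_rect hab hT
  set S := Icc a b ×ˢ Icc 0 T with hSdef
  set F : ℝ × ℝ → ℝ := Function.uncurry u with hF
  set V : ℝ × ℝ → ℝ := fun z => Real.exp (γ * z.2) * u z.1 z.2 with hVdef
  have hV : ContDiffOn ℝ ((k + 2 : ℕ) : WithTop ℕ∞) V S := by
    refine ContDiffOn.mul (ContDiff.contDiffOn ?_) hsmooth
    exact Real.contDiff_exp.comp (contDiff_const.mul contDiff_snd)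
  have hF2 : ContDiffOn ℝ ((2 : ℕ) : WithTop ℕ∞) F S :=
    hsmooth.of_le (by exact_mod_cast (by omega : 2 ≤ k + 2))
  have hV2 : ContDiffOn ℝ ((2 : ℕ) : WithTop ℕ∞) V S :=
    hV.of_le (by exact_mod_cast (by omega : 2 ≤ k + 2))
  set p := dirDeriv S (1, 0) F with hp
  set q := dirDeriv S (1, 0) p with hq
  have hpk : ContDiffOn ℝ ((k + 1 : ℕ) : WithTop ℕ∞) p S := dirDeriv_contDiffOn hS _ hsmooth
  have hp1 : ContDiffOn ℝ ((1 : ℕ) : WithTop ℕ∞) p S := dirDeriv_contDiffOn hS _ hF2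
  have hq0 : ContinuousOn q S := (dirDeriv_contDiffOn hS (1, 0) (n := 0) hp1).continuousOn
  have hδ' : 1 - δ ≠ 1 / 2 := fun h => hδ (by linarith)
  obtain ⟨B₁, hB₁0, hB₁⟩ := exists_poly_approx_rect (n := k + 1) hab hT
    (hsmooth.of_le (by exact_mod_cast (by omega : k + 1 ≤ k + 2)))
  obtain ⟨B₂, hB₂0, hB₂⟩ := exists_poly_approx_rect (n := k + 1) hab hT hpk
  obtain ⟨B₃, hB₃0, hB₃⟩ := exists_poly_approx_increment (n := k + 1) hab hT hV
  obtain ⟨K₁, hK₁0, hK₁⟩ := gaussRadau_accuracy k hδ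
  obtain ⟨K₂, hK₂0, hK₂⟩ := gaussRadau_accuracy k hδ'
  obtain ⟨Kc, hKc0, hKc⟩ := exists_l1_consistency (γ := γ) hα₀ hα₁ hab hT hV2
  have hΓ : 0 < Real.Gamma (2 - α) := Real.Gamma_pos_of_pos (by linarith)
  have hTp : 0 < T ^ (1 - α) := Real.rpow_pos_of_pos hT _
  set g₁ := ρ * (K₁ * B₁)
    + Real.exp (1 * |γ| * T) * (K₁ * B₃) * T ^ (1 - α) / Real.Gamma (2 - α) + Kc with hg₁
  set g₂ := K₂ * B₂ with hg₂
  have hg₁0 : 0 ≤ g₁ := by positivity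
  set E := Real.exp (2 * |γ| * T) with hE
  -- One factor E comes from inserting the weight e^{2γt}, the other from removing it; 4 is the 2 of
  -- the triangle inequality times the 2 of the stability bound.
  set A := 2 * (K₁ * B₁) ^ 2 * (b - a)
    + 4 * E ^ 2 / ρ * ((g₁ ^ 2 / (2 * ρ) + g₂ ^ 2 / 4) * (b - a)) with hA
  have hba : 0 < b - a := sub_pos.2 hab
  have hA0 : 0 ≤ A := by positivity
  refine ⟨Real.sqrt A + 1, by positivity, ?_⟩
  intro N _ m M τ hτ hMT uh ph h n hnM
  have htime : ∀ i : ℕ, i ≤ M → (i : ℝ) * τ ∈ Icc 0 T := fun i hi =>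
    ⟨by positivity, (mul_le_mul_of_nonneg_right (by exact_mod_cast hi) hτ.le).trans hMT⟩
  have hh : 0 < m.size ^ (k + 1) := pow_pos m.size_pos _
  have hτ2 : 0 < τ ^ (2 - α) := Real.rpow_pos_of_pos hτ _
  set H := m.size ^ (k + 1) + τ ^ (2 - α) with hH
  have hH0 : 0 < H := by positivity
  have hhH : m.size ^ (k + 1) ≤ H := by linarith
  have huc : ∀ t ∈ Icc 0 T, ContinuousOn (fun x => u x t) (Icc a b) := fun t ht =>
    continuousOn_slice hsmooth.continuousOn ht
  have hpc : ∀ t ∈ Icc 0 T, ContinuousOn (fun x => p (x, t)) (Icc a b) := fun t ht =>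
    continuousOn_slice hp1.continuousOn ht
  have hVc : ∀ t ∈ Icc 0 T, ContinuousOn (fun x => V (x, t)) (Icc a b) := fun t ht =>
    continuousOn_slice hV.continuousOn ht
  have hexP : ∀ i : ℕ, ∃ P, i ≤ M → IsGaussRadauProj m k δ (fun x => u x (i * τ)) P := by
    intro i
    by_cases hi : i ≤ M
    · obtain ⟨P, hP⟩ := (hK₁ m _ B₁ (huc _ (htime i hi)) hB₁0 (hB₁ _ (htime i hi))).1
      exact ⟨P, fun _ => hP⟩
    · exact ⟨0, fun h => absurd h hi⟩
  choose P hP using hexP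
  have hPb : ∀ i ≤ M, ∀ j, ∀ x ∈ Icc (m.left j) (m.right j),
      |(P i j).eval x - u x (i * τ)| ≤ K₁ * B₁ * m.size ^ (k + 1) := fun i hi =>
    (hK₁ m _ B₁ (huc _ (htime i hi)) hB₁0 (hB₁ _ (htime i hi))).2 _ (hP i hi)
  have hinc : ∀ i, i + 1 ≤ M → ∀ j, ∀ x ∈ Icc (m.left j) (m.right j),
      |(Real.exp (γ * (((i + 1 : ℕ) : ℝ) * τ)) * (P (i + 1) j).eval x
          - Real.exp (γ * (((i + 1 : ℕ) : ℝ) * τ)) * u x (((i + 1 : ℕ) : ℝ) * τ))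
        - (Real.exp (γ * (i * τ)) * (P i j).eval x - Real.exp (γ * (i * τ)) * u x (i * τ))|
      ≤ K₁ * B₃ * m.size ^ (k + 1) * τ := by
    intro i hi j x hx
    have ht := htime (i + 1) hi
    have hs := htime i (by omega)
    -- The combination of projections is a projection of the increment of V = e^{γt}u, and
    -- `gaussRadau_accuracy` bounds every such projection.
    have hlin := (IsGaussRadauProj.lincomb (huc _ ht) (huc _ hs) (hP (i + 1) hi)
      (hP i (by omega)) (Real.exp (γ * (((i + 1 : ℕ) : ℝ) * τ))) (-Real.exp (γ * (i * τ)))).congr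
      (g₂ := fun x => V (x, ((i + 1 : ℕ) : ℝ) * τ) - V (x, i * τ))
      (fun x _ => by simp only [hVdef]; ring)
    have hstep : |((i + 1 : ℕ) : ℝ) * τ - i * τ| = τ := by
      rw [show ((i + 1 : ℕ) : ℝ) * τ - i * τ = τ by push_cast; ring, abs_of_pos hτ]
    have happ := hB₃ _ ht _ hs
    rw [hstep] at happ
    have := (hK₁ m _ (B₃ * τ) ((hVc _ ht).fun_sub (hVc _ hs)) (by positivity) happ).2 _ hlin j x hx
    simp only [eval_add, eval_mul, eval_C, hVdef] at this
    calc _ = _ := by congr 1; ring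
      _ ≤ _ := this
      _ = _ := by ring
  -- The scheme starts from the same projection, so by uniqueness the initial discrete error is
  -- zero.
  have hξ0 : pairing m (fun j => P 0 j - uh 0 j) (fun j => P 0 j - uh 0 j) = 0 := by
    have h1 := (hP 0 (Nat.zero_le _)).congr (g₂ := u₀) fun x hx => by
      simpa using hu.initial x hx
    have hu0 : ContinuousOn u₀ (Icc a b) := by
      refine (huc 0 ⟨le_rfl, hT.le⟩).congr fun x hx => (hu.initial x hx).symm
    rw [h1.unique hδ hu0 h.start]
    simp [pairing]
  set G₁ := g₁ * H with hG₁
  set G₂ := g₂ * H with hG₂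
  set κ := (G₁ ^ 2 / (2 * ρ) + G₂ ^ 2 / 4) * (b - a) with hκ
  have hκ0 : 0 ≤ κ := by positivity
  have hE0 : 0 < E := Real.exp_pos _
  have hmain := l1_stability m (γ := γ) (τ := τ) (K := E * κ) (κ := κ) (M := M)
    (ξ := fun i j => P i j - uh i j) hα₀ hα₁ hρ
    (c := τ ^ (-α) / Real.Gamma (2 - α)) (div_nonneg (Real.rpow_nonneg hτ.le _) hΓ.le)
    (by positivity) hξ0
    (fun i hi => mul_le_mul_of_nonneg_right (exp_mul_le 2 zero_le_two (htime i hi)) hκ0)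
    (fun i hi hiM => by
      have ht := htime i hiM
      have hi0 : (0 : ℝ) < i := by exact_mod_cast hi
      have ht' : (i : ℝ) * τ ∈ Ioc 0 T := ⟨by positivity, ht.2⟩
      obtain ⟨Q, hQ⟩ := (hK₂ m _ B₂ (hpc _ ht) hB₂0 (hB₂ _ ht)).1
      have hQb := (hK₂ m _ B₂ (hpc _ ht) hB₂0 (hB₂ _ ht)).2 Q hQ
      have hdu : ∀ x ∈ Icc a b,
          HasDerivWithinAt (fun y => u y (i * τ)) (p (x, i * τ)) (Icc a b) x := fun x hx =>
        hasDerivWithinAt_fst (hF2.differentiableOn (by simp)) hx ht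
      have hdp : ∀ x ∈ Icc a b,
          HasDerivWithinAt (fun y => p (y, i * τ)) (q (x, i * τ)) (Icc a b) x := fun x hx =>
        hasDerivWithinAt_fst (hp1.differentiableOn (by simp)) hx ht
      have hpper : p (a, i * τ) = p (b, i * τ) := by
        rw [← (hdu a (left_mem_Icc.2 hab.le)).derivWithin
            (uniqueDiffOn_Icc hab a (left_mem_Icc.2 hab.le)),
          ← (hdu b (right_mem_Icc.2 hab.le)).derivWithin
            (uniqueDiffOn_Icc hab b (right_mem_Icc.2 hab.le))]
        exact hu.periodic_deriv _ ht
      have hcap : ContinuousOn (fun x => temperedCaputo α γ (fun s => u x s) (i * τ)) (Icc a b) :=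
        continuousOn_const.mul (continuousOn_caputo hα₁ hab hT
          (hV.of_le (by exact_mod_cast (by omega : 1 ≤ k + 2))) ht')
      refine energy_step h hρ hi hiM (P := P) (Q := Q) (z := fun x => u x (i * τ))
        (p := fun x => p (x, i * τ)) (q := fun x => q (x, i * τ))
        (d := fun x => temperedCaputo α γ (fun s => u x s) (i * τ))
        (huc _ ht) (hpc _ ht) (continuousOn_slice hq0 ht) hcap (hP i hiM).mem hQ.mem
        (fun v hv => (hP i hiM).weak_derivative (hu.periodic _ ht) hdu (hpc _ ht) hv)
        (fun v hv => hQ.weak_derivative hpper hdp (continuousOn_slice hq0 ht) hv)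
        (fun x hx => ?_) (fun j x hx => ?_) (fun j x hx => ?_)
      · rw [← hu.equation x hx _ ht']
        exact congrArg _ (iteratedDeriv_two_eq hab hT hF2 hx ht).symm
      · have hx' := m.Icc_subset j hx
        have e1 := hPb i hiM j x hx
        have e2 := hKc x hx' τ hτ i hi ht.2
        have e3 := abs_l1_projection_error_le (γ := γ) hα₁ hτ hi ht.2
          (y := fun r => Real.exp (γ * (r * τ)) * (P r j).eval x - Real.exp (γ * (r * τ)) * u x (r * τ))
          (A := K₁ * B₃ * m.size ^ (k + 1)) (by positivity)
          (fun r hr => hinc r (by omega) j x hx)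
        rw [l1Op_sub] at e3
        rw [l1Diff_eval]
        -- Insert the L1 difference of the exact solution, separating the L1 difference of the
        -- projection error from the truncation error.
        have e4 : ∀ X Y Z W : ℝ, X + (Y - Z) = X + ((Y - W) + (W - Z)) := fun _ _ _ _ => by ring
        rw [e4 _ _ _ (τ ^ (-α) / Real.Gamma (2 - α) * (Real.exp (-γ * (i * τ))
          * l1Op α (fun r => Real.exp (γ * (r * τ)) * u x (r * τ)) i)), ← mul_sub, ← mul_sub]
        refine (abs_add_le _ _).trans ((add_le_add_right (abs_add_le _ _) _).trans ?_)
        rw [abs_mul ρ, abs_of_pos hρ]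
        have f1 : ρ * |(P i j).eval x - u x (i * τ)| ≤ ρ * (K₁ * B₁) * H :=
          calc _ ≤ ρ * (K₁ * B₁ * m.size ^ (k + 1)) := mul_le_mul_of_nonneg_left e1 hρ.le
            _ ≤ ρ * (K₁ * B₁ * H) := by gcongr
            _ = _ := by ring
        have f2 : Kc * τ ^ (2 - α) ≤ Kc * H := by
          refine mul_le_mul_of_nonneg_left ?_ hKc0
          linarith
        have f3 : Real.exp (1 * |γ| * T) * (K₁ * B₃ * m.size ^ (k + 1)) * T ^ (1 - α)
              / Real.Gamma (2 - α)
            ≤ Real.exp (1 * |γ| * T) * (K₁ * B₃) * T ^ (1 - α) / Real.Gamma (2 - α) * H :=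
          calc _ = Real.exp (1 * |γ| * T) * (K₁ * B₃) * T ^ (1 - α) / Real.Gamma (2 - α)
                * m.size ^ (k + 1) := by ring
            _ ≤ _ := by gcongr
        calc _ ≤ ρ * (K₁ * B₁) * H
              + (Real.exp (1 * |γ| * T) * (K₁ * B₃) * T ^ (1 - α) / Real.Gamma (2 - α) * H
                + Kc * H) := add_le_add f1 (add_le_add (e3.trans f3) (e2.trans f2))
          _ = G₁ := by rw [hG₁, hg₁]; ring
      · refine (hQb j x hx).trans ?_
        rw [hG₂, hg₂]
        gcongr)
    n hnM
  have hpair : pairing m (fun j => P n j - uh n j) (fun j => P n j - uh n j)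
      ≤ 2 * E ^ 2 / ρ * κ := by
    have hinv : Real.exp (-(2 * γ * (n * τ))) ≤ E := by
      have := exp_mul_le (γ := -γ) 2 zero_le_two (htime n hnM)
      rw [abs_neg] at this
      rw [show -(2 * γ * (n * τ)) = 2 * -γ * (n * τ) by ring]
      exact this
    have h1 := mul_le_mul_of_nonneg_left hmain (Real.exp_pos (-(2 * γ * (n * τ)))).le
    rw [← mul_assoc, ← Real.exp_add, neg_add_cancel, Real.exp_zero, one_mul] at h1
    refine h1.trans ((mul_le_mul_of_nonneg_right hinv (by positivity)).trans_eq ?_)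
    ring
  have hsq : ∑ j, ∫ x in m.left j..m.right j, (u x (n * τ) - (uh n j).eval x) ^ 2 ≤ A * H ^ 2 := by
    refine (sum_integral_sq_le m (huc _ (htime n hnM)) (P := P n) (W := uh n)
      (G := K₁ * B₁ * H) fun j x hx => (hPb n hnM j x hx).trans (by gcongr)).trans ?_
    calc _ ≤ 2 * (K₁ * B₁ * H) ^ 2 * (b - a) + 2 * (2 * E ^ 2 / ρ * κ) := by gcongr
      _ = A * H ^ 2 := by
        rw [hA, hκ, hG₁, hG₂]
        ring
  calc l2Error m (fun x => u x (n * τ)) (uh n) ≤ Real.sqrt (A * H ^ 2) := Real.sqrt_le_sqrt hsq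
    _ = Real.sqrt A * H := by rw [Real.sqrt_mul hA0, Real.sqrt_sq hH0.le]
    _ ≤ (Real.sqrt A + 1) * H := by
      refine mul_le_mul_of_nonneg_right ?_ hH0.le
      linarith

end TemperedLDG

theorem mainTheorem2
    (α γ ρ a b T δ κ : ℝ) (k : ℕ)
    (hα₀ : 0 < α) (hα₁ : α < 1) (hρ : 0 < ρ) (hab : a < b) (hT : 0 < T)
    (hδ : δ ≠ 1 / 2) (hκ : 0 < κ)
    (f : ℝ → ℝ → ℝ) (u₀ : ℝ → ℝ) (u : ℝ → ℝ → ℝ)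
    (hu : TemperedLDG.IsExactSolution α γ ρ a b T f u₀ u)
    (hsmooth : ContDiffOn ℝ ((k + 2 : ℕ) : WithTop ℕ∞) (Function.uncurry u)
      (Set.Icc a b ×ˢ Set.Icc 0 T)) :
    ∃ C : ℝ, 0 < C ∧
      ∀ (N : ℕ) [NeZero N] (m : TemperedLDG.Mesh a b N), m.QuasiUniform κ →
      ∀ (M : ℕ), 0 < M →
      ∀ (uh ph : ℕ → Fin N → Polynomial ℝ),
        TemperedLDG.IsLDGSolution α γ ρ δ (T / (M : ℝ)) k M m f u₀ uh ph →
      ∀ n : ℕ, n ≤ M →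
        TemperedLDG.l2Error m (fun x => u x ((n : ℝ) * (T / (M : ℝ)))) (uh n)
          ≤ C * (m.size ^ (k + 1) + (T / (M : ℝ)) ^ (2 - α)) := by
  obtain ⟨C, hC, h⟩ := TemperedLDG.exists_error_bound hα₀ hα₁ hρ hab hT hδ hu hsmooth
  refine ⟨C, hC, fun N _ m _ M hM uh ph hsol n hn => ?_⟩
  have hM' : (0 : ℝ) < M := by exact_mod_cast hM
  exact h N m M (T / M) (by positivity) (mul_div_cancel₀ T hM'.ne').le uh ph hsol n hn
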